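/- **Market.** Let $(\Omega,\mathbb P)$ be a probability space carrying two independent Poisson processes $Z^B,Z^S$ on $[0,1]$ (noise buy and sell orders of unit size) with intensity $\beta>0$, put $Z=Z^B-Z^S$, and let $\tilde v$ be a random variable independent of the noise orders with $\mathbb P(\tilde v=v_n)\in(0,1)$, $n=1,\dots,N$, $\sum_n\mathbb P(\tilde v=v_n)=1$, where $N<\infty$ and $v_1<\dots<v_N$. Suppose there is a strictly increasing sequence $(a_n)_{n=1}^{N+1}$ in $\mathbb Z\cup\{\pm\infty\}$ with $a_1=-\infty$, $a_{N+1}=\infty$, $\bigcup_{n=1}^{N}[a_n,a_{n+1})=\mathbb Z\cup\{-\infty\}$, such that $\mathbb P(Z_1\in[a_n,a_{n+1}))=\mathbb P(\tilde v=v_n)$ and $m_n=(a_n+a_{n+1}-1)/2$ is not an integer, for every $n$. (So $m_1=-\infty$ and $m_N=+\infty$.) **Prices and the bound.** Let $P(y)=v_n$ for $y\in[a_n,a_{n+1})$, and let the pricing rule be $$p(y,t)=\sum_{n=1}^N v_n\,\mathbb P\big(y+Z_{1-t}\in[a_n,a_{n+1})\big),\qquad y\in\mathbb Z,\ t\in[0,1].$$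 For $y>m_n$ put $$U(v_n,y,t)=\sum_{j=a_{n+1}}^{y}\big(P(j-1)-v_n\big)+\beta\int_t^1\big(p(y,r)-p(y-1,r)\big)\,dr ,$$ for $y<m_n$ put $$U(v_n,y,t)=\sum_{j=y}^{a_n-1}\big(v_n-P(j+1)\big)+\beta\int_t^1\big(p(y+1,r)-p(y,r)\big)\,dr ,$$ and let $U^S(v_n,y,t)=U(v_n,y,t)$ for $y>m_n$ and $U^S(v_n,y,t)=U(v_n,y-1,t)$ for $y<m_n$. **Strategies.** An admissible strategy consists of a filtration $\mathcal F^I$ and processes $X^B,X^S$ such that: $\mathcal F^I$ satisfies the usual conditions and is generated by $\sigma(\tilde v)$, the noise orders and a filtration $\mathcal H$ independent of $\tilde v$ and the noise orders; $X^B,X^S$ are $\mathcal F^I$-adapted integrable point processes with unit jumps, starting at $0$, whose dual predictable projections are absolutely continuous in time; and $\mathbb E\int_0^1|p(Y_t,t)|\,|dX^i_t-\theta^i_t\,dt|<\infty$ for $i\in\{B,S\}$, where $\theta^i$ is the intensity of $X^i$ and $Y=Y_0+Z+X^B-X^S$ is the total demand, with $Y_0\in\mathbb Z$ an arbitrary constant.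 Let $\theta^{B,B},\theta^{B,T},\theta^{B,S}$ be the $\mathcal F^I$-intensities of the parts of $X^B$ whose jumps coincide, respectively, with no noise order, with a jump of $Z^B$, and with a jump of $Z^S$; let $\theta^{S,S},\theta^{S,T},\theta^{S,B}$ be the intensities of the parts of $X^S$ whose jumps coincide with no noise order, with a jump of $Z^S$, and with a jump of $Z^B$. **Value function.** For $t\in[0,1)$ let $$\begin{aligned}V(v_n,y,t)=\sup\ \mathbb E\Big[\int_t^1\Big\{&(v_n-p(Y_{r-}+1,r))\theta^{B,B}_r+(v_n-p(Y_{r-}+2,r))\theta^{B,T}_r+(v_n-p(Y_{r-},r))\theta^{B,S}_r\\&-(v_n-p(Y_{r-}-1,r))\theta^{S,S}_r-(v_n-p(Y_{r-}-2,r))\theta^{S,T}_r-(v_n-p(Y_{r-},r))\theta^{S,B}_r\Big\}dr\ \Big|\ Y_t=y,\ \tilde v=v_n\Big],\end{aligned}$$ the supremum being over all admissible strategies and initial demands $Y_0$ for which the conditioning event has positive probability, and let $V(v_n,y,1)=\lim_{t\uparrow1}V(v_n,y,t)$ (read as the upper limit). **Proposition.** For all $n\in\{1,\dots,N\}$, $y\in\mathbb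 Z$ and $t\in[0,1]$, $$V(v_n,y,t)\le U^S(v_n,y,t).$$ In particular $V$ is finite: $-\infty<V(v_n,y,t)<\infty$. -/

import Mathlib

open MeasureTheory ProbabilityTheory Filter Topology Set
open scoped NNReal ENNReal unitInterval

namespace GlostenMilgrom

noncomputable section

/-! ### Counting processes on the time interval `I = [0,1]` -/

/-- The path of a point process with unit jumps: it starts at `0`, is nondecreasing and
right-continuous, and increases by at most one unit at a time. -/
structure IsCountingPath (f : I → ℕ) : Prop where
  zero : f 0 = 0
  mono : Monotone f
  rightCont : ∀ t, ContinuousWithinAt f (Ici t) t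
  jump_le : ∀ t, f t ≤ Function.leftLim f t + 1

/-- The jump `f t - f (t-)` of a counting path (it is `0` or `1`; at time `0` there is none). -/
def jump (f : I → ℕ) (t : I) : ℕ := f t - Function.leftLim f t

/-- A Poisson process on `[0,1]` with constant intensity `β`. -/
structure IsPoissonProcess {Ω : Type*} [MeasurableSpace Ω] (X : I → Ω → ℕ) (β : ℝ≥0)
    (P : Measure Ω) : Prop where
  path : ∀ ω, IsCountingPath fun t => X t ω
  measurable : ∀ t, Measurable (X t)
  law : ∀ s t : I, s ≤ t →
    P.map (X t - X s) = poissonMeasure (β * Real.toNNReal ((t : ℝ) - (s : ℝ)))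
  indep : HasIndepIncrements X P

/-- The σ-algebra generated by the null events of `P`. -/
abbrev nullSigma {Ω : Type*} [MeasurableSpace Ω] (P : Measure Ω) : MeasurableSpace Ω :=
  MeasurableSpace.generateFrom {A | MeasurableSet A ∧ P A = 0}

theorem nullSigma_le {Ω : Type*} [mΩ : MeasurableSpace Ω] (P : Measure Ω) :
    nullSigma P ≤ mΩ :=
  MeasurableSpace.generateFrom_le fun _ h => h.1

/-- The usual augmentation of a filtration: the smallest right-continuous filtration that
contains it and all null events. -/
def augmentation {Ω : Type*} [mΩ : MeasurableSpace Ω] (P : Measure Ω) (𝓖 : Filtration I mΩ) :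
    Filtration I mΩ :=
  (𝓖 ⊔ Filtration.const I (nullSigma P) (nullSigma_le P)).rightCont

/-- `θ` is the `(𝓕, P)`-intensity of the point process whose jump at time `s` is `J s`:
the dual predictable projection of that process is `∫ θ ds`. That is, `θ` is predictable and
`E[∫ C dX] = E[∫ C θ ds]` for all predictable `C ≥ 0`, where `∫ C dX = ∑ C_s ΔX_s`. -/
structure IsIntensity {Ω : Type*} [mΩ : MeasurableSpace Ω] (P : Measure Ω)
    (𝓕 : Filtration I mΩ) (J : I → Ω → ℕ) (θ : I → Ω → ℝ≥0) : Prop where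
  predictable : IsStronglyPredictable 𝓕 θ
  projection : ∀ C : I → Ω → ℝ≥0∞, IsStronglyPredictable 𝓕 C →
    ∫⁻ ω, ∑' s : I, C s ω * (J s ω : ℝ≥0∞) ∂P = ∫⁻ ω, (∫⁻ s : I, C s ω * (θ s ω : ℝ≥0∞)) ∂P

/-! ### The market -/

/-- The market with unit order size: the fundamental value takes the values
`v 0 < v 1 < ... < v (N - 1)`, and noise traders submit buy and sell orders according to the
independent Poisson processes `ZB` and `ZS` with intensity `β`, independently of the value. -/
structure Market (Ω : Type*) [MeasurableSpace Ω] (N : ℕ) where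
  P : Measure Ω
  isProbabilityMeasure : IsProbabilityMeasure P
  β : ℝ≥0
  β_pos : 0 < β
  v : Fin N → ℝ
  v_strictMono : StrictMono v
  value : Ω → ℝ
  measurable_value : Measurable value
  value_mem : ∀ᵐ ω ∂P, ∃ n, value ω = v n
  prob_pos : ∀ n, 0 < P {ω | value ω = v n}
  prob_lt_one : ∀ n, P {ω | value ω = v n} < 1
  ZB : I → Ω → ℕ
  ZS : I → Ω → ℕ
  poisson_ZB : IsPoissonProcess ZB β P
  poisson_ZS : IsPoissonProcess ZS β P
  indep_ZB_ZS : IndepFun (fun ω t => ZB t ω) (fun ω t => ZS t ω) P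
  indep_value : IndepFun value (fun ω t => (ZB t ω, ZS t ω)) P

namespace Market

variable {Ω : Type*} [mΩ : MeasurableSpace Ω] {N : ℕ}

/-- The cumulative demand `Z = ZB - ZS` of the noise traders. -/
def Z (M : Market Ω N) (t : I) (ω : Ω) : ℤ := (M.ZB t ω : ℤ) - (M.ZS t ω : ℤ)

theorem measurable_noise (M : Market Ω N) (t : I) :
    Measurable fun ω => (M.ZB t ω, M.ZS t ω) :=
  (M.poisson_ZB.measurable t).prodMk (M.poisson_ZS.measurable t)

/-- The filtration of the noise orders, before augmentation. (Almost surely `ZB` and `ZS` have no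
common jump, so after augmentation this is the filtration generated by `Z = ZB - ZS`.) -/
def noiseFiltration (M : Market Ω N) : Filtration I mΩ :=
  Filtration.natural (fun t ω => (M.ZB t ω, M.ZS t ω))
    fun t => (M.measurable_noise t).stronglyMeasurable

/-- The σ-algebra generated by the fundamental value. -/
abbrev valueSigma (M : Market Ω N) : MeasurableSpace Ω :=
  MeasurableSpace.comap M.value inferInstance

/-- The insider's filtration: the filtration satisfying the usual conditions that is generated by
the fundamental value, the noise orders and the additional information `𝓗`. -/
def insiderFiltration (M : Market Ω N) (𝓗 : Filtration I mΩ) : Filtration I mΩ :=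
  augmentation M.P
    (Filtration.const I M.valueSigma M.measurable_value.comap_le ⊔ M.noiseFiltration ⊔ 𝓗)

/-! ### Levels, the pricing rule and the bounding function

A sequence of levels is `a : Fin (N + 1) → EReal`; the `n`-th interval is
`[a n.castSucc, a n.succ)`. -/

/-- The integer `y` lies in the `n`-th interval. -/
def InInterval (a : Fin (N + 1) → EReal) (n : Fin N) (y : ℤ) : Prop :=
  a n.castSucc ≤ ((y : ℝ) : EReal) ∧ ((y : ℝ) : EReal) < a n.succ

/-- The middle level `m_n = (a_n + a_{n+1} - 1) / 2`; it is `-∞` for the lowest and `+∞` for the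
highest value. -/
def middle (a : Fin (N + 1) → EReal) (n : Fin N) : EReal :=
  (a n.castSucc + a n.succ - 1) / 2

/-- The integer `y` is above the middle level. When the middle level is not an integer this says
that `y` is at least the smallest integer above it, and `¬ Above a n y` that `y` is at most the
largest integer below it. -/
def Above (a : Fin (N + 1) → EReal) (n : Fin N) (y : ℤ) : Prop :=
  middle a n < ((y : ℝ) : EReal)

/-- The assumption on the law of the fundamental value. -/
structure IsLevelSequence (M : Market Ω N) (a : Fin (N + 1) → EReal) : Prop where
  strictMono : StrictMono a
  mem : ∀ i, a i = ⊥ ∨ a i = ⊤ ∨ ∃ k : ℤ, a i = ((k : ℝ) : EReal)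
  first : a 0 = ⊥
  last : a (Fin.last N) = ⊤
  cover : ∀ y : ℤ, ∃ n, InInterval a n y
  law : ∀ n, M.P {ω | InInterval a n (M.Z 1 ω)} = M.P {ω | M.value ω = M.v n}
  middle_ne : ∀ n, ∀ k : ℤ, middle a n ≠ ((k : ℝ) : EReal)

/-- `h_n(y,t)`, the probability that `Z_{1-t}`, started from `y`, is in the `n`-th interval. -/
def h (M : Market Ω N) (a : Fin (N + 1) → EReal) (n : Fin N) (y : ℤ) (t : I) : ℝ :=
  M.P.real {ω | InInterval a n (y + M.Z (unitInterval.symm t) ω)}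

/-- The pricing rule `p(y,t) = ∑ v_n h_n(y,t)`. -/
def p (M : Market Ω N) (a : Fin (N + 1) → EReal) (y : ℤ) (t : I) : ℝ :=
  ∑ n, M.v n * M.h a n y t

open Classical in
/-- The terminal pricing function: `P(y) = v_n` for `y` in the `n`-th interval. -/
def terminalPrice (M : Market Ω N) (a : Fin (N + 1) → EReal) (y : ℤ) : ℝ :=
  ∑ n, if InInterval a n y then M.v n else 0

open Classical in
/-- `U(v_n, y, 1)`: below the middle level the sum of `v_n - P(j + 1)` over `y ≤ j ≤ a_n - 1`,
above it the sum of `P(j - 1) - v_n` over `a_{n+1} ≤ j ≤ y`. -/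
def terminalU (M : Market Ω N) (a : Fin (N + 1) → EReal) (n : Fin N) (y : ℤ) : ℝ :=
  if Above a n y then
    ∑ᶠ (j : ℤ) (_ : a n.succ ≤ ((j : ℝ) : EReal) ∧ j ≤ y), (M.terminalPrice a (j - 1) - M.v n)
  else
    ∑ᶠ (j : ℤ) (_ : y ≤ j ∧ ((j : ℝ) : EReal) < a n.castSucc),
      (M.v n - M.terminalPrice a (j + 1))

open Classical in
/-- The function `U(v_n, y, t)`. -/
def U (M : Market Ω N) (a : Fin (N + 1) → EReal) (n : Fin N) (y : ℤ) (t : I) : ℝ :=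
  M.terminalU a n y +
    if Above a n y then (M.β : ℝ) * ∫ r in Ioc t 1, (M.p a y r - M.p a (y - 1) r)
    else (M.β : ℝ) * ∫ r in Ioc t 1, (M.p a (y + 1) r - M.p a y r)

open Classical in
/-- The function `U^S(v_n, y, t)`: the one-step shift of `U` below the middle level. -/
def US (M : Market Ω N) (a : Fin (N + 1) → EReal) (n : Fin N) (y : ℤ) (t : I) : ℝ :=
  if Above a n y then M.U a n y t else M.U a n (y - 1) t

/-! ### Insider strategies and the value function -/

/-- The total demand `Y = y₀ + Z + XB - XS` when the demand at time `0` is `y₀`. -/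
def demand (M : Market Ω N) (y₀ : ℤ) (XB XS : I → Ω → ℕ) (t : I) (ω : Ω) : ℤ :=
  y₀ + M.Z t ω + (XB t ω : ℤ) - (XS t ω : ℤ)

/-- The jumps of `X` that coincide with jumps of the noise process `W`. -/
def jumpWith (X W : I → Ω → ℕ) (t : I) (ω : Ω) : ℕ :=
  jump (fun s => X s ω) t * jump (fun s => W s ω) t

/-- The jumps of `X` that do not coincide with any noise order. -/
def jumpAlone (M : Market Ω N) (X : I → Ω → ℕ) (t : I) (ω : Ω) : ℕ :=
  jump (fun s => X s ω) t *
    ((1 - jump (fun s => M.ZB s ω) t) * (1 - jump (fun s => M.ZS s ω) t))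

/-- An admissible strategy `(XB, XS; 𝓕)` of the insider when the pricing rule is `q` and the
demand at time `0` is `y₀`. The additional information `𝓗` is independent of the fundamental value
and the noise orders. The buy orders `XB` split into those placed alone (`BB`), those on top of a
noise buy order (`BT`) and those cancelling a noise sell order (`BS`); sell orders are split
likewise, and `θij` is the intensity of the part `ij`. -/
structure Strategy (M : Market Ω N) (q : ℤ → I → ℝ) (y₀ : ℤ) where
  𝓗 : Filtration I mΩ
  indep_𝓗 : Indep (⨆ t, 𝓗 t) (M.valueSigma ⊔ ⨆ t, M.noiseFiltration t) M.P
  XB : I → Ω → ℕ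
  XS : I → Ω → ℕ
  path_XB : ∀ ω, IsCountingPath fun t => XB t ω
  path_XS : ∀ ω, IsCountingPath fun t => XS t ω
  adapted_XB : Adapted (M.insiderFiltration 𝓗) XB
  adapted_XS : Adapted (M.insiderFiltration 𝓗) XS
  integrable_XB : ∫⁻ ω, (XB 1 ω : ℝ≥0∞) ∂M.P < ∞
  integrable_XS : ∫⁻ ω, (XS 1 ω : ℝ≥0∞) ∂M.P < ∞
  θBB : I → Ω → ℝ≥0
  θBT : I → Ω → ℝ≥0
  θBS : I → Ω → ℝ≥0
  θSS : I → Ω → ℝ≥0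
  θST : I → Ω → ℝ≥0
  θSB : I → Ω → ℝ≥0
  intensity_BB : IsIntensity M.P (M.insiderFiltration 𝓗) (M.jumpAlone XB) θBB
  intensity_BT : IsIntensity M.P (M.insiderFiltration 𝓗) (jumpWith XB M.ZB) θBT
  intensity_BS : IsIntensity M.P (M.insiderFiltration 𝓗) (jumpWith XB M.ZS) θBS
  intensity_SS : IsIntensity M.P (M.insiderFiltration 𝓗) (M.jumpAlone XS) θSS
  intensity_ST : IsIntensity M.P (M.insiderFiltration 𝓗) (jumpWith XS M.ZS) θST
  intensity_SB : IsIntensity M.P (M.insiderFiltration 𝓗) (jumpWith XS M.ZB) θSB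
  /-- `E[∫ |q(Y_t,t)| |dXB_t - θB_t dt|] < ∞`, where the variation of the compensated process is
  the sum of that of its jump part and that of its absolutely continuous part. -/
  price_integrable_B :
    ∫⁻ ω, ((∑' s : I, ENNReal.ofReal |q (M.demand y₀ XB XS s ω) s| *
          (jump (fun r => XB r ω) s : ℝ≥0∞)) +
        ∫⁻ s : I, ENNReal.ofReal |q (M.demand y₀ XB XS s ω) s| *
          ((θBB s ω + θBT s ω + θBS s ω : ℝ≥0) : ℝ≥0∞)) ∂M.P < ∞
  price_integrable_S :
    ∫⁻ ω, ((∑' s : I, ENNReal.ofReal |q (M.demand y₀ XB XS s ω) s| *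
          (jump (fun r => XS r ω) s : ℝ≥0∞)) +
        ∫⁻ s : I, ENNReal.ofReal |q (M.demand y₀ XB XS s ω) s| *
          ((θSS s ω + θST s ω + θSB s ω : ℝ≥0) : ℝ≥0∞)) ∂M.P < ∞

namespace Strategy

variable {M : Market Ω N} {q : ℤ → I → ℝ} {y₀ : ℤ}

/-- The total demand `Y`. -/
def Y (S : M.Strategy q y₀) : I → Ω → ℤ := M.demand y₀ S.XB S.XS

/-- The left limit `Y_{t-}`. -/
def Yminus (S : M.Strategy q y₀) (t : I) (ω : Ω) : ℤ := Function.leftLim (fun s => S.Y s ω) t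

/-- The event `Y_t = y` and `value = v_n`. -/
def event (S : M.Strategy q y₀) (n : Fin N) (y : ℤ) (t : I) : Set Ω :=
  {ω | S.Y t ω = y ∧ M.value ω = M.v n}

/-- The rate at which expected profit accrues at time `r` when the fundamental value is `x`. -/
def profitRate (S : M.Strategy q y₀) (x : ℝ) (r : I) (ω : Ω) : ℝ :=
  (x - q (S.Yminus r ω + 1) r) * S.θBB r ω
    + (x - q (S.Yminus r ω + 2) r) * S.θBT r ω
    + (x - q (S.Yminus r ω) r) * S.θBS r ω
    - (x - q (S.Yminus r ω - 1) r) * S.θSS r ω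
    - (x - q (S.Yminus r ω - 2) r) * S.θST r ω
    - (x - q (S.Yminus r ω) r) * S.θSB r ω

/-- The expected profit on `[t,1]` given `Y_t = y` and `value = v_n`. -/
def expectedProfit (S : M.Strategy q y₀) (n : Fin N) (y : ℤ) (t : I) : ℝ :=
  ∫ ω, (∫ r in Ioc t 1, S.profitRate (M.v n) r ω) ∂(cond M.P (S.event n y t))

end Strategy

/-- The value function before the terminal time, for the pricing rule `p`: the supremum of the
expected profit on `[t,1]` given `Y_t = y` and `value = v_n`, over all admissible strategies (with
any initial demand) that reach this event with positive probability. -/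
def valueBefore (M : Market Ω N) (a : Fin (N + 1) → EReal) (n : Fin N) (y : ℤ) (t : I) : EReal :=
  ⨆ (y₀ : ℤ) (S : M.Strategy (M.p a) y₀) (_ : M.P (S.event n y t) ≠ 0),
    ((S.expectedProfit n y t : ℝ) : EReal)

open Classical in
/-- The value function `V(v_n, y, t)`. At `t = 1` it is the limit of the values at `s < 1`; the
upper limit is used so that existence of the limit need not be known. -/
def valueFunction (M : Market Ω N) (a : Fin (N + 1) → EReal) (n : Fin N) (y : ℤ) (t : I) :
    EReal :=
  if t = 1 then limsup (fun s => M.valueBefore a n y s) (𝓝[<] (1 : I))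
  else M.valueBefore a n y t

end Market

end

end GlostenMilgrom

/-!
The function `US` is a supersolution of the insider's control problem, and the bound is the
verification argument for it, carried out pathwise.

Both branches of the definition of `US` are given by one formula,
`US y t = T y + β ∫_t^1 (p y - p (y - 1))`, where `T ≥ 0` is the terminal value and
`T (y + 1) - T y = P y - v_n` (`US_eq`, `terminalUS_nonneg`, `terminalUS_succ`). The pricing rule is
the mean of `P (y + Z_{1-t})`, hence it satisfies the backward equation
`p y t - P y = β ∫_t^1 (p (y + 1) - 2 p y + p (y - 1))` (`p_sub_terminalPrice`, from the Kolmogorov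
equation `noiseMean_sub_eq` of the noise demand). Together these give
`US (y + 1) t - US y t = p y t - v_n` (`US_succ`).

Consider an order at a time when the demand before it is `y`. As `p` is nondecreasing in the demand,
the profit of the insider is at most the decrease of `US`, up to `p y - v_n` for a noise buy order
and `v_n - p (y - 1)` for a noise sell order (`jumpProfit_le`). Summing over all orders after `t`,
together with the decrease of `US` in time, bounds the profit by `US (Y_t) t` plus a sum over the
noise orders minus the same expression with noise orders replaced by their rate `β`
(`sum_jumpProfit_le`).

In expectation the latter two cancel, because the noise orders have intensity `β` also in the
filtration of the insider (`isCompensated_ZB`, `isCompensated_ZS` and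
`IsCompensated.integral_tsum_eq`), while the integrals of the profit rates against the intensities of the insider's orders become sums
over these orders (`IsIntensity.integral_prod_eq`). All integrands are bounded and left limits of
adapted processes, so that their integrals against counting paths are limits of Riemann sums; no
stochastic integration beyond that is needed. The result is `Strategy.setIntegral_profitRate_le`.

For the lower bound, the strategy without orders has profit `0` and reaches every event
`Y_t = y`, `v = v_n` with positive probability when it starts from the demand `y`. At the terminal
time both bounds pass to the upper limit, as `US` is continuous there (`tendsto_US`).
-/

namespace GlostenMilgrom

variable {Ω : Type*} [mΩ : MeasurableSpace Ω]

/-! ### Step paths -/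

/-- `w` is a right-continuous path on `[0,1]` which is constant on some interval to the left and
to the right of every time, and `w'` is its path of left limits (with `w' 0 = w 0`). -/
structure IsStepPath {α : Type*} (w w' : I → α) : Prop where
  left : ∀ t, ∀ᶠ s in 𝓝[<] t, w s = w' t
  right : ∀ t, ∀ᶠ s in 𝓝[>] t, w s = w t
  zero : w' 0 = w 0

namespace IsStepPath

variable {α γ : Type*} {w w' : I → α}

theorem map (h : IsStepPath w w') (F : α → γ) :
    IsStepPath (fun t => F (w t)) fun t => F (w' t) where
  left t := (h.left t).mono fun _ hs => congrArg F hs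
  right t := (h.right t).mono fun _ hs => congrArg F hs
  zero := congrArg F h.zero

theorem prodMk {v v' : I → γ} (h : IsStepPath w w') (hv : IsStepPath v v') :
    IsStepPath (fun t => (w t, v t)) fun t => (w' t, v' t) where
  left t := by filter_upwards [h.left t, hv.left t] with s h1 h2 using by rw [h1, h2]
  right t := by filter_upwards [h.right t, hv.right t] with s h1 h2 using by rw [h1, h2]
  zero := by rw [h.zero, hv.zero]

theorem nhdsLT_neBot {t : I} (ht : 0 < t) : (𝓝[<] t).NeBot :=
  nhdsLT_neBot_of_exists_lt ⟨0, ht⟩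

/-- Left limits are unique. -/
theorem eq_of_eventually_left (h : IsStepPath w w') {t : I} (ht : 0 < t) {c : α}
    (hc : ∀ᶠ s in 𝓝[<] t, w s = c) : w' t = c := by
  have := nhdsLT_neBot ht
  obtain ⟨s, h1, h2⟩ := ((h.left t).and hc).exists
  exact h1.symm.trans h2

theorem left' (h : IsStepPath w w') (t : I) : ∀ᶠ s in 𝓝[<] t, w' s = w' t := by
  have h1 := eventually_eventually_nhdsWithin.2 (h.left t)
  filter_upwards [h1, self_mem_nhdsWithin, h.left t] with s hs hst hsw
  rcases eq_or_lt_of_le s.2.1 with h0 | h0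
  · have : s = 0 := Subtype.ext h0.symm
    subst this
    rw [h.zero, hsw]
  · refine h.eq_of_eventually_left (t := s) h0 ?_
    rw [IsOpen.nhdsWithin_eq isOpen_Iio hst] at hs
    exact hs.filter_mono nhdsWithin_le_nhds

theorem right' (h : IsStepPath w w') (t : I) : ∀ᶠ s in 𝓝[>] t, w' s = w t := by
  have h1 := eventually_eventually_nhdsWithin.2 (h.right t)
  filter_upwards [h1, self_mem_nhdsWithin] with s hs hst
  refine h.eq_of_eventually_left (t := s) (lt_of_le_of_lt bot_le hst) ?_
  rw [IsOpen.nhdsWithin_eq isOpen_Ioi hst] at hs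
  exact hs.filter_mono nhdsWithin_le_nhds

/-- A step path has finitely many jumps. -/
theorem finite_jumps (h : IsStepPath w w') : {t | w' t ≠ w t}.Finite := by
  by_contra hinf
  obtain ⟨t, -, ht⟩ := Set.Infinite.exists_accPt_of_subset_isCompact hinf isCompact_univ
    (subset_univ _)
  rw [accPt_iff_frequently_nhdsNE] at ht
  apply ht
  rw [← Set.Iio_union_Ioi, nhdsWithin_union, eventually_sup]
  constructor
  · filter_upwards [h.left t, h.left' t] with s h1 h2 h3 using h3 (h2.trans h1.symm)
  · filter_upwards [h.right t, h.right' t] with s h1 h2 h3 using h3 (h2.trans h1.symm)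

/-- The increment of a real step path is the sum of its jumps. -/
theorem sub_eq_sum {w w' : I → ℝ} (h : IsStepPath w w') (J : Finset I)
    (hJ : ∀ t, w' t ≠ w t → t ∈ J) {t u : I} (htu : t ≤ u) :
    w u - w t = ∑ s ∈ J with t < s ∧ s ≤ u, (w s - w' s) := by
  -- Subtracting its jumps from `w` leaves a locally constant function on a connected interval.
  set Φ : I → ℝ := fun u => w u - ∑ s ∈ J with s ≤ u, (w s - w' s) with hΦ
  have key : IsLocallyConstant Φ := by
    rw [IsLocallyConstant.iff_eventually_eq]
    intro x
    have hfin : ∀ᶠ s in 𝓝[≠] x, s ∉ J := by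
      have hc : IsClosed ((↑J : Set I) \ {x}) := (J.finite_toSet.subset sdiff_subset).isClosed
      have h2 : ((↑J : Set I) \ {x})ᶜ ∈ 𝓝 x := hc.isOpen_compl.mem_nhds (by simp)
      filter_upwards [nhdsWithin_le_nhds h2, self_mem_nhdsWithin] with s hs hsx hsJ
      exact hs ⟨hsJ, hsx⟩
    rw [← Set.Iio_union_Ioi, nhdsWithin_union, eventually_sup] at hfin
    rw [← nhdsNE_sup_pure, ← Set.Iio_union_Ioi, nhdsWithin_union, eventually_sup, eventually_sup]
    refine ⟨⟨?_, ?_⟩, by simp⟩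
    · have hf := hfin.1
      obtain hb | hb := eq_or_neBot (𝓝[<] x)
      · simp [hb]
      obtain ⟨a, hax, ha⟩ : ∃ a < x, ∀ s ∈ Ioo a x, s ∉ J := by
        obtain ⟨b, hbx⟩ : ∃ b, b < x := (self_mem_nhdsWithin (s := Iio x)|> hb.nonempty_of_mem)
        exact (mem_nhdsLT_iff_exists_Ioo_subset' hbx).1 hf
      filter_upwards [h.left x, Ioo_mem_nhdsLT hax] with y hy hya
      have h1 : ∑ s ∈ J with s ≤ x, (w s - w' s)
          = ∑ s ∈ J with s ≤ y, (w s - w' s) + (w x - w' x) := by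
        have e : J.filter (· < x) = J.filter (· ≤ y) := by
          ext s
          simp only [Finset.mem_filter, and_congr_right_iff]
          intro hsJ
          refine ⟨fun hs => ?_, fun hs => hs.trans_lt hya.2⟩
          by_contra hsy
          exact ha s ⟨hya.1.trans (not_le.1 hsy), hs⟩ hsJ
        rw [← e]
        by_cases hx : x ∈ J
        · have : J.filter (· ≤ x) = insert x (J.filter (· < x)) := by
            ext s
            simp only [Finset.mem_filter, Finset.mem_insert, le_iff_lt_or_eq]
            constructor
            · tauto
            · rintro (rfl | h) <;> tauto
          rw [this, Finset.sum_insert (by simp), add_comm]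
        · have hw : w x - w' x = 0 := by
            by_contra hne
            exact hx (hJ x fun h => hne (by rw [h, sub_self]))
          rw [hw, add_zero]
          refine Finset.sum_congr ?_ fun _ _ => rfl
          ext s
          simp only [Finset.mem_filter, and_congr_right_iff, le_iff_lt_or_eq]
          intro hs
          have : s ≠ x := fun h => hx (h ▸ hs)
          tauto
      simp only [hΦ, h1, hy]
      ring
    · have hf := hfin.2
      obtain hb | hb := eq_or_neBot (𝓝[>] x)
      · simp [hb]
      obtain ⟨a, hax, ha⟩ : ∃ a > x, ∀ s ∈ Ioo x a, s ∉ J := by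
        obtain ⟨b, hbx⟩ : ∃ b, x < b := (self_mem_nhdsWithin (s := Ioi x)|> hb.nonempty_of_mem)
        exact (mem_nhdsGT_iff_exists_Ioo_subset' hbx).1 hf
      filter_upwards [h.right x, Ioo_mem_nhdsGT hax] with y hy hya
      have e : J.filter (· ≤ y) = J.filter (· ≤ x) := by
        ext s
        simp only [Finset.mem_filter, and_congr_right_iff]
        intro hsJ
        refine ⟨fun hs => ?_, fun hs => hs.trans hya.1.le⟩
        by_contra hsy
        exact ha s ⟨not_le.1 hsy, hs.trans_lt hya.2⟩ hsJ
      simp only [hΦ, e, hy]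
  have h1 : Φ u = Φ t := key.apply_eq_of_preconnectedSpace u t
  have h2 : ∑ s ∈ J with s ≤ u, (w s - w' s)
      = ∑ s ∈ J with s ≤ t, (w s - w' s) + ∑ s ∈ J with t < s ∧ s ≤ u, (w s - w' s) := by
    rw [← Finset.sum_filter_add_sum_filter_not (J.filter (· ≤ u)) (· ≤ t), Finset.filter_filter,
      Finset.filter_filter]
    congr 1
    · refine Finset.sum_congr (Finset.filter_congr fun s _ => ?_) fun _ _ => rfl
      exact ⟨fun h => h.2, fun h => ⟨h.trans htu, h⟩⟩
    · refine Finset.sum_congr (Finset.filter_congr fun s _ => ?_) fun _ _ => rfl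
      rw [not_le, and_comm]
  simp only [hΦ] at h1
  linarith

end IsStepPath

/-! ### Counting paths -/

namespace IsCountingPath

variable {f : I → ℕ}

theorem isStepPath (hf : IsCountingPath f) : IsStepPath f (Function.leftLim f) where
  left t := by
    have h := hf.mono.tendsto_leftLim t
    rw [nhds_discrete, tendsto_pure] at h
    exact h
  right t := by
    have h := (hf.rightCont t).tendsto
    rw [nhds_discrete, tendsto_pure] at h
    exact h.filter_mono (nhdsWithin_mono _ Ioi_subset_Ici_self)
  zero := leftLim_eq_of_isBot isBot_bot

theorem leftLim_add_jump (hf : IsCountingPath f) (t : I) :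
    Function.leftLim f t + jump f t = f t :=
  Nat.add_sub_cancel' (hf.mono.leftLim_le le_rfl)

theorem jump_le_one (hf : IsCountingPath f) (t : I) : jump f t ≤ 1 := by
  have := hf.jump_le t
  unfold jump
  omega

theorem jump_zero (hf : IsCountingPath f) : jump f 0 = 0 := by
  rw [jump, hf.isStepPath.zero, Nat.sub_self]

theorem jump_eq_zero_iff (hf : IsCountingPath f) (t : I) :
    jump f t = 0 ↔ Function.leftLim f t = f t := by
  have := hf.leftLim_add_jump t
  omega

theorem cast_jump (hf : IsCountingPath f) (t : I) :
    (jump f t : ℝ) = f t - Function.leftLim f t := by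
  rw [← hf.leftLim_add_jump t]
  push_cast
  ring

theorem finite_support_jump (hf : IsCountingPath f) : (Function.support (jump f)).Finite := by
  refine hf.isStepPath.finite_jumps.subset fun t ht => ?_
  exact fun h => ht ((hf.jump_eq_zero_iff t).2 h)

theorem sub_eq_sum_jump (hf : IsCountingPath f) (J : Finset I)
    (hJ : ∀ t, jump f t ≠ 0 → t ∈ J) {t u : I} (htu : t ≤ u) :
    (f u : ℝ) - f t = ∑ s ∈ J with t < s ∧ s ≤ u, (jump f s : ℝ) := by
  rw [(hf.isStepPath.map (fun n : ℕ => (n : ℝ))).sub_eq_sum J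
    (fun t ht => hJ t fun h => ht (congrArg _ ((hf.jump_eq_zero_iff t).1 h))) htu]
  exact Finset.sum_congr rfl fun s _ => (hf.cast_jump s).symm

/-- The value at time `1` counts the jumps. -/
theorem sum_jump (hf : IsCountingPath f) (J : Finset I) (hJ : ∀ t, jump f t ≠ 0 → t ∈ J) :
    ∑ s ∈ J, (jump f s : ℝ) = f 1 := by
  have h := hf.sub_eq_sum_jump J hJ (t := 0) (u := 1) bot_le
  rw [hf.zero, Nat.cast_zero, sub_zero, Finset.sum_filter] at h
  rw [h]
  refine Finset.sum_congr rfl fun s _ => ?_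
  split_ifs with hs
  · rfl
  · have : s = 0 := by
      by_contra h0
      exact hs ⟨bot_lt_iff_ne_bot.2 h0, le_top⟩
    rw [this, hf.jump_zero, Nat.cast_zero]

end IsCountingPath

/-! ### Discretization of time -/

/-- The grid point `k / (n + 1)`, cut off at `1`. -/
noncomputable def grid (n k : ℕ) : I := projIcc 0 1 zero_le_one ((k : ℝ) / (n + 1))

/-- The index `k` of the grid interval `(k / (n + 1), (k + 1) / (n + 1)]` that contains `s > 0`. -/
noncomputable def gridIdx (n : ℕ) (s : I) : ℕ := ⌈(s : ℝ) * (n + 1)⌉₊ - 1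

theorem coe_grid {n k : ℕ} (hk : k ≤ n + 1) : (grid n k : ℝ) = (k : ℝ) / (n + 1) := by
  rw [grid, projIcc_of_mem]
  have : (k : ℝ) ≤ n + 1 := by exact_mod_cast hk
  exact ⟨by positivity, (div_le_one (by positivity)).2 this⟩

theorem grid_mono (n : ℕ) : Monotone (grid n) := fun a b hab =>
  monotone_projIcc zero_le_one (by gcongr)

theorem mem_Ioc_grid_iff {n k : ℕ} (hk : k < n + 1) (s : I) :
    s ∈ Ioc (grid n k) (grid n (k + 1)) ↔ 0 < s ∧ k = gridIdx n s := by
  have hn : (0 : ℝ) < n + 1 := by positivity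
  rw [mem_Ioc, ← Subtype.coe_lt_coe, ← Subtype.coe_le_coe, coe_grid hk.le, coe_grid hk,
    div_lt_iff₀ hn, le_div_iff₀ hn, ← Nat.lt_ceil, ← Nat.ceil_le, gridIdx]
  constructor
  · rintro ⟨h1, h2⟩
    refine ⟨?_, by omega⟩
    by_contra h0
    have : s = 0 := le_antisymm (not_lt.1 h0) bot_le
    subst this
    simp at h1
  · rintro ⟨h0, h1⟩
    have : 0 < ⌈(s : ℝ) * (n + 1)⌉₊ := Nat.ceil_pos.2 (mul_pos h0 hn)
    omega

theorem gridIdx_lt {n : ℕ} (s : I) : gridIdx n s < n + 1 := by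
  have : ⌈(s : ℝ) * (n + 1)⌉₊ ≤ n + 1 := by
    rw [Nat.ceil_le]
    push_cast
    exact mul_le_of_le_one_left (by positivity) s.2.2
  unfold gridIdx
  omega

theorem mem_Ioc_gridIdx {n : ℕ} {s : I} (hs : 0 < s) :
    s ∈ Ioc (grid n (gridIdx n s)) (grid n (gridIdx n s + 1)) :=
  (mem_Ioc_grid_iff (gridIdx_lt s) s).2 ⟨hs, rfl⟩

theorem grid_succ_sub {n k : ℕ} (hk : k < n + 1) :
    (grid n (k + 1) : ℝ) - grid n k = 1 / (n + 1) := by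
  rw [coe_grid hk, coe_grid hk.le]
  push_cast
  ring

theorem tendsto_grid_gridIdx {s : I} (hs : 0 < s) :
    Tendsto (fun n => grid n (gridIdx n s)) atTop (𝓝[<] s) := by
  refine tendsto_nhdsWithin_iff.2 ⟨?_, .of_forall fun n => (mem_Ioc_gridIdx hs).1⟩
  rw [tendsto_subtype_rng]
  refine tendsto_of_tendsto_of_tendsto_of_le_of_le (g := fun n : ℕ => (s : ℝ) - 1 / (n + 1))
    (h := fun _ => (s : ℝ)) ?_ tendsto_const_nhds ?_ fun n => (mem_Ioc_gridIdx hs).1.le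
  · simpa using tendsto_const_nhds.sub (tendsto_one_div_add_atTop_nhds_zero_nat (𝕜 := ℝ))
  · intro n
    have h1 := grid_succ_sub (n := n) (gridIdx_lt s)
    have h2 : (s : ℝ) ≤ grid n (gridIdx n s + 1) := (mem_Ioc_gridIdx hs).2
    show (s : ℝ) - 1 / (n + 1) ≤ grid n (gridIdx n s)
    linarith

theorem tendsto_grid_gridIdx_succ {s : I} (hs : 0 < s) :
    Tendsto (fun n => grid n (gridIdx n s + 1)) atTop (𝓝[≥] s) := by
  refine tendsto_nhdsWithin_iff.2 ⟨?_, .of_forall fun n => (mem_Ioc_gridIdx hs).2⟩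
  rw [tendsto_subtype_rng]
  refine tendsto_of_tendsto_of_tendsto_of_le_of_le (g := fun _ => (s : ℝ))
    (h := fun n : ℕ => (s : ℝ) + 1 / (n + 1)) tendsto_const_nhds ?_
    (fun n => (mem_Ioc_gridIdx hs).2) ?_
  · simpa using tendsto_const_nhds.add (tendsto_one_div_add_atTop_nhds_zero_nat (𝕜 := ℝ))
  · intro n
    have h1 := grid_succ_sub (n := n) (gridIdx_lt s)
    have h2 : (grid n (gridIdx n s) : ℝ) < s := (mem_Ioc_gridIdx hs).1
    show (grid n (gridIdx n s + 1) : ℝ) ≤ s + 1 / (n + 1)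
    linarith

theorem IsCountingPath.eventually_grid_sub_eq_jump {f : I → ℕ} (hf : IsCountingPath f) {s : I}
    (hs : 0 < s) :
    ∀ᶠ n in atTop, f (grid n (gridIdx n s + 1)) - f (grid n (gridIdx n s)) = jump f s := by
  have h2 : ∀ᶠ u in 𝓝[≥] s, f u = f s := by
    have h := (hf.rightCont s).tendsto
    rwa [nhds_discrete, tendsto_pure] at h
  filter_upwards [(tendsto_grid_gridIdx hs).eventually (hf.isStepPath.left s),
    (tendsto_grid_gridIdx_succ hs).eventually h2] with n h1 h2
  rw [h1, h2, jump]

/-- The Riemann sum of a function against a counting path, as a sum over the jump times. -/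
theorem IsCountingPath.sum_grid {f : I → ℕ} (hf : IsCountingPath f) (J : Finset I)
    (hJ : ∀ t, jump f t ≠ 0 → t ∈ J) (n : ℕ) (d : ℕ → ℝ) :
    ∑ k ∈ Finset.range (n + 1), d k * ((f (grid n (k + 1)) : ℝ) - f (grid n k))
      = ∑ s ∈ J, d (gridIdx n s) * jump f s := by
  have h1 : ∀ k ∈ Finset.range (n + 1), d k * ((f (grid n (k + 1)) : ℝ) - f (grid n k))
      = ∑ s ∈ J, if k = gridIdx n s then d k * jump f s else 0 := by
    intro k hk
    rw [hf.sub_eq_sum_jump J hJ (grid_mono n k.le_succ), Finset.mul_sum, Finset.sum_filter]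
    refine Finset.sum_congr rfl fun s _ => ?_
    have h2 := mem_Ioc_grid_iff (Finset.mem_range.1 hk) s
    rw [mem_Ioc] at h2
    rcases eq_or_lt_of_le (show (0 : I) ≤ s from bot_le) with h0 | h0
    · rw [← h0, hf.jump_zero]
      simp
    · simp only [h2, h0, true_and]
  rw [Finset.sum_congr rfl h1, Finset.sum_comm]
  refine Finset.sum_congr rfl fun s _ => ?_
  rw [Finset.sum_ite_eq' (Finset.range (n + 1)) (gridIdx n s) fun k => d k * (jump f s : ℝ),
    if_pos (Finset.mem_range.2 (gridIdx_lt s))]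

/-! ### Left limits of adapted processes -/

/-- The bounded process `ξ` is adapted and has left limits `ξ'`; at time `0` the process of left
limits is set to be `0`. -/
structure IsLeftLimit (𝓕 : Filtration I mΩ) (K : ℝ) (ξ ξ' : I → Ω → ℝ) : Prop where
  measurable : ∀ t, Measurable[𝓕 t] (ξ t)
  bound : ∀ t ω, |ξ t ω| ≤ K
  left : ∀ ω s, Tendsto (fun r => ξ r ω) (𝓝[<] s) (𝓝 (ξ' s ω))
  zero : ∀ ω, ξ' 0 ω = 0

/-- `D s` is, for every `s > 0`, the limit of random variables that depend on the grid interval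
containing `s` only. -/
def IsGridLimit (D : I → Ω → ℝ) : Prop :=
  ∃ d : ℕ → ℕ → Ω → ℝ, (∀ n k, Measurable (d n k)) ∧
    ∀ ω s, 0 < s → Tendsto (fun n => d n (gridIdx n s) ω) atTop (𝓝 (D s ω))

theorem IsGridLimit.mul {D E : I → Ω → ℝ} (hD : IsGridLimit D) (hE : IsGridLimit E) :
    IsGridLimit fun s ω => D s ω * E s ω := by
  obtain ⟨d, hd, hd'⟩ := hD
  obtain ⟨e, he, he'⟩ := hE
  exact ⟨fun n k ω => d n k ω * e n k ω, fun n k => (hd n k).mul (he n k),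
    fun ω s hs => (hd' ω s hs).mul (he' ω s hs)⟩

theorem IsGridLimit.one : IsGridLimit fun (_ : I) (_ : Ω) => (1 : ℝ) :=
  ⟨fun _ _ _ => 1, fun _ _ => measurable_const, fun _ _ _ => tendsto_const_nhds⟩

/-- Functions of the jumps of two counting processes. -/
theorem IsGridLimit.jump {X W : I → Ω → ℕ} (hX : ∀ ω, IsCountingPath fun t => X t ω)
    (hXm : ∀ t, Measurable (X t)) (hW : ∀ ω, IsCountingPath fun t => W t ω)
    (hWm : ∀ t, Measurable (W t)) (g : ℕ → ℕ → ℝ) :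
    IsGridLimit fun s ω => g (jump (fun t => X t ω) s) (jump (fun t => W t ω) s) := by
  refine ⟨fun n k ω => g (X (grid n (k + 1)) ω - X (grid n k) ω)
    (W (grid n (k + 1)) ω - W (grid n k) ω), fun n k => ?_, fun ω s hs => ?_⟩
  · exact (Measurable.of_discrete (f := fun x : ℕ × ℕ => g x.1 x.2)).comp
      (((hXm _).sub (hXm _)).prodMk ((hWm _).sub (hWm _)))
  · refine tendsto_const_nhds.congr' ?_
    filter_upwards [(hX ω).eventually_grid_sub_eq_jump hs,
      (hW ω).eventually_grid_sub_eq_jump hs] with n h1 h2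
    rw [h1, h2]

namespace IsLeftLimit

variable {𝓕 : Filtration I mΩ} {K : ℝ} {ξ ξ' : I → Ω → ℝ}

theorem bound' (h : IsLeftLimit 𝓕 K ξ ξ') (s : I) (ω : Ω) : |ξ' s ω| ≤ K := by
  rcases eq_or_lt_of_le (show (0 : I) ≤ s from bot_le) with h0 | h0
  · rw [← h0, h.zero, abs_zero]
    exact (abs_nonneg _).trans (h.bound 0 ω)
  · have := IsStepPath.nhdsLT_neBot h0
    exact le_of_tendsto (h.left ω s).abs (.of_forall fun r => h.bound r ω)

theorem isGridLimit (h : IsLeftLimit 𝓕 K ξ ξ') : IsGridLimit ξ' :=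
  ⟨fun n k => ξ (grid n k), fun _ _ => (h.measurable _).mono (𝓕.le _) le_rfl,
    fun ω s hs => (h.left ω s).comp (tendsto_grid_gridIdx hs)⟩

theorem neg (h : IsLeftLimit 𝓕 K ξ ξ') :
    IsLeftLimit 𝓕 K (fun s ω => -ξ s ω) fun s ω => -ξ' s ω where
  measurable t := (h.measurable t).neg
  bound t ω := by rw [abs_neg]; exact h.bound t ω
  left ω s := (h.left ω s).neg
  zero ω := by rw [h.zero, neg_zero]

theorem posPart (h : IsLeftLimit 𝓕 K ξ ξ') :
    IsLeftLimit 𝓕 K (fun s ω => max (ξ s ω) 0) fun s ω => max (ξ' s ω) 0 where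
  measurable t := (h.measurable t).max measurable_const
  bound t ω := by
    rw [abs_of_nonneg (le_max_right _ _)]
    exact max_le ((le_abs_self _).trans (h.bound t ω)) ((abs_nonneg _).trans (h.bound t ω))
  left ω s := (h.left ω s).max tendsto_const_nhds
  zero ω := by rw [h.zero, max_self]

/-- The approximation of `ξ'` by a process that is constant on the grid intervals. -/
theorem tendsto_sum_grid (h : IsLeftLimit 𝓕 K ξ ξ') (s : I) (ω : Ω) :
    Tendsto (fun n => ∑ k ∈ Finset.range (n + 1),
      (Ioc (grid n k) (grid n (k + 1))).indicator (fun _ => ξ (grid n k) ω) s)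
      atTop (𝓝 (ξ' s ω)) := by
  rcases eq_or_lt_of_le (show (0 : I) ≤ s from bot_le) with h0 | h0
  · rw [← h0, h.zero]
    refine tendsto_const_nhds.congr fun n => ?_
    refine (Finset.sum_eq_zero fun k _ => indicator_of_notMem ?_ _).symm
    exact fun hk => not_lt_bot hk.1
  · refine ((h.left ω s).comp (tendsto_grid_gridIdx h0)).congr fun n => ?_
    rw [Finset.sum_eq_single_of_mem (gridIdx n s) (Finset.mem_range.2 (gridIdx_lt s))]
    · rw [indicator_of_mem (mem_Ioc_gridIdx h0)]
      rfl
    · intro k hk hne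
      refine indicator_of_notMem (fun hm => hne ?_) _
      exact ((mem_Ioc_grid_iff (Finset.mem_range.1 hk) s).1 hm).2

/-- Processes of left limits of adapted processes are predictable. -/
theorem measurable_predictable (h : IsLeftLimit 𝓕 K ξ ξ') :
    Measurable[𝓕.predictable] (Function.uncurry ξ') := by
  let : MeasurableSpace (I × Ω) := 𝓕.predictable
  refine measurable_of_tendsto_metrizable (f := fun n (x : I × Ω) =>
    ∑ k ∈ Finset.range (n + 1),
      (Ioc (grid n k) (grid n (k + 1))).indicator (fun _ => ξ (grid n k) x.2) x.1) ?_
    (tendsto_pi_nhds.2 fun x => h.tendsto_sum_grid x.1 x.2)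
  intro n
  refine Finset.measurable_sum _ fun k _ => ?_
  intro B hB
  have h1 : MeasurableSet[𝓕.predictable]
      (Ioc (grid n k) (grid n (k + 1)) ×ˢ (ξ (grid n k) ⁻¹' B)) :=
    measurableSet_predictable_Ioc_prod _ _ (h.measurable _ hB)
  have h2 : MeasurableSet[𝓕.predictable]
      (Ioc (grid n k) (grid n (k + 1)) ×ˢ (univ : Set Ω)) :=
    measurableSet_predictable_Ioc_prod _ _ MeasurableSet.univ
  by_cases h0 : (0 : ℝ) ∈ B
  · convert! h1.union h2.compl using 1
    ext x
    by_cases hx : x.1 ∈ Ioc (grid n k) (grid n (k + 1))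
    · rw [mem_preimage, indicator_of_mem hx, mem_union, mem_compl_iff, mem_prod, mem_prod]
      simp only [hx, mem_univ, true_and, not_true_eq_false, or_false, mem_preimage]
    · rw [mem_preimage, indicator_of_notMem hx, mem_union, mem_compl_iff, mem_prod, mem_prod]
      simp only [hx, h0, false_and, not_false_eq_true, or_true]
  · convert! h1 using 1
    ext x
    by_cases hx : x.1 ∈ Ioc (grid n k) (grid n (k + 1))
    · rw [mem_preimage, indicator_of_mem hx, mem_prod]
      simp only [hx, true_and, mem_preimage]
    · rw [mem_preimage, indicator_of_notMem hx, mem_prod]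
      simp only [hx, h0, false_and]

end IsLeftLimit

theorem predictable_le (𝓕 : Filtration I mΩ) :
    𝓕.predictable ≤ (Prod.instMeasurableSpace : MeasurableSpace (I × Ω)) :=
  measurableSpace_le_predictable_of_measurableSet
    (fun A hA => (measurableSet_singleton _).prod (𝓕.le _ A hA))
    fun _ A hA => measurableSet_Ioi.prod (𝓕.le _ A hA)

theorem IsLeftLimit.measurable_uncurry {𝓕 : Filtration I mΩ} {K : ℝ} {ξ ξ' : I → Ω → ℝ}
    (h : IsLeftLimit 𝓕 K ξ ξ') : Measurable fun z : Ω × I => ξ' z.2 z.1 :=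
  (h.measurable_predictable.mono (predictable_le 𝓕) le_rfl).comp measurable_swap

/-! ### Sums over the jumps of a counting process -/

/-- A point process with unit jumps whose number of points is integrable. -/
structure IsCountingProcess (P : Measure Ω) (X : I → Ω → ℕ) : Prop where
  path : ∀ ω, IsCountingPath fun t => X t ω
  measurable : ∀ t, Measurable (X t)
  integrable : Integrable (fun ω => (X 1 ω : ℝ)) P

/-- `J` selects some of the jumps of `X` according to a measurable rule. -/
structure IsJumpPart (X J : I → Ω → ℕ) : Prop where
  le : ∀ s ω, J s ω ≤ jump (fun t => X t ω) s
  factor : ∃ m : I → Ω → ℝ, IsGridLimit m ∧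
    ∀ s ω, (J s ω : ℝ) = m s ω * jump (fun t => X t ω) s

theorem IsJumpPart.tsum_mul_eq {X J : I → Ω → ℕ} (hJ : IsJumpPart X J) (c : I → ℝ) {ω : Ω}
    {A : Finset I} (hA : ∀ t, jump (fun t => X t ω) t ≠ 0 → t ∈ A) :
    ∑' s : I, c s * (J s ω : ℝ) = ∑ s ∈ A, c s * (J s ω : ℝ) := by
  refine tsum_eq_sum fun t ht => ?_
  have h1 := hJ.le t ω
  rw [not_imp_comm.1 (hA t) ht] at h1
  rw [Nat.le_zero.1 h1, Nat.cast_zero, mul_zero]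

/-- All jumps of `X`. -/
theorem IsJumpPart.refl (X : I → Ω → ℕ) : IsJumpPart X fun s ω => jump (fun t => X t ω) s :=
  ⟨fun _ _ => le_rfl, _, IsGridLimit.one, fun _ _ => (one_mul _).symm⟩

namespace IsCountingProcess

variable {P : Measure Ω} {X J : I → Ω → ℕ}

theorem measurable_tsum_mul_jump (hX : IsCountingProcess P X) {D : I → Ω → ℝ}
    (hD : IsGridLimit D) :
    Measurable fun ω => ∑' s : I, D s ω * jump (fun t => X t ω) s := by
  obtain ⟨d, hd, hd'⟩ := hD
  refine measurable_of_tendsto_metrizable (f := fun n ω => ∑ k ∈ Finset.range (n + 1),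
    d n k ω * ((X (grid n (k + 1)) ω : ℝ) - X (grid n k) ω)) (fun n => ?_)
    (tendsto_pi_nhds.2 fun ω => ?_)
  · refine Finset.measurable_sum _ fun k _ => (hd n k).mul (Measurable.sub ?_ ?_)
    · exact measurable_from_top.comp (hX.measurable _)
    · exact measurable_from_top.comp (hX.measurable _)
  · have hfin := (hX.path ω).finite_support_jump
    have hmem : ∀ t, jump (fun t => X t ω) t ≠ 0 → t ∈ hfin.toFinset := by simp
    rw [tsum_eq_sum (s := hfin.toFinset) (fun t ht => by
      rw [not_imp_comm.1 (hmem t) ht, Nat.cast_zero, mul_zero])]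
    simp_rw [(hX.path ω).sum_grid _ hmem]
    refine tendsto_finsetSum _ fun s hs => (hd' ω s ?_).mul_const _
    rcases eq_or_lt_of_le (show (0 : I) ≤ s from bot_le) with h0 | h0
    · rw [← h0] at hs
      simp [(hX.path ω).jump_zero] at hs
    · exact h0

theorem measurable_tsum (hX : IsCountingProcess P X) (hJ : IsJumpPart X J) {D : I → Ω → ℝ}
    (hD : IsGridLimit D) : Measurable fun ω => ∑' s : I, D s ω * (J s ω : ℝ) := by
  obtain ⟨m, hm, hm'⟩ := hJ.factor
  simp_rw [hm', ← mul_assoc]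
  exact hX.measurable_tsum_mul_jump (hD.mul hm)

theorem abs_tsum_le (hX : IsCountingProcess P X) (hJ : IsJumpPart X J) {c : I → ℝ} {K : ℝ}
    (hc : ∀ s, |c s| ≤ K) (ω : Ω) : |∑' s : I, c s * (J s ω : ℝ)| ≤ K * X 1 ω := by
  have hfin := (hX.path ω).finite_support_jump
  have hmem : ∀ t, jump (fun t => X t ω) t ≠ 0 → t ∈ hfin.toFinset := by simp
  rw [hJ.tsum_mul_eq c hmem, ← (hX.path ω).sum_jump _ hmem, Finset.mul_sum]
  refine (Finset.abs_sum_le_sum_abs _ _).trans (Finset.sum_le_sum fun s _ => ?_)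
  rw [abs_mul, Nat.abs_cast]
  exact mul_le_mul (hc s) (Nat.cast_le.2 (hJ.le s ω)) (Nat.cast_nonneg _)
    ((abs_nonneg _).trans (hc s))

theorem integrable_tsum (hX : IsCountingProcess P X) (hJ : IsJumpPart X J)
    {𝓕 : Filtration I mΩ} {K : ℝ} {ξ ξ' : I → Ω → ℝ} (hξ : IsLeftLimit 𝓕 K ξ ξ') :
    Integrable (fun ω => ∑' s : I, ξ' s ω * (J s ω : ℝ)) P :=
  (hX.integrable.const_mul K).mono' (hX.measurable_tsum hJ hξ.isGridLimit).aestronglyMeasurable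
    (.of_forall fun ω => hX.abs_tsum_le hJ (fun s => hξ.bound' s ω) ω)

theorem ofReal_tsum (hX : IsCountingProcess P X) (hJ : IsJumpPart X J) {c : I → ℝ}
    (hc : ∀ s, 0 ≤ c s) (ω : Ω) :
    ∑' s : I, ENNReal.ofReal (c s) * (J s ω : ℝ≥0∞)
      = ENNReal.ofReal (∑' s : I, c s * (J s ω : ℝ)) := by
  have hfin := (hX.path ω).finite_support_jump
  have hmem : ∀ t, jump (fun t => X t ω) t ≠ 0 → t ∈ hfin.toFinset := by simp
  rw [hJ.tsum_mul_eq c hmem, ENNReal.ofReal_sum_of_nonneg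
    fun s _ => mul_nonneg (hc s) (Nat.cast_nonneg _)]
  rw [tsum_eq_sum (s := hfin.toFinset)]
  · refine Finset.sum_congr rfl fun s _ => ?_
    rw [ENNReal.ofReal_mul (hc s), ENNReal.ofReal_natCast]
  · intro t ht
    have h1 := hJ.le t ω
    rw [not_imp_comm.1 (hmem t) ht] at h1
    rw [Nat.le_zero.1 h1, Nat.cast_zero, mul_zero]

end IsCountingProcess

namespace IsIntensity

variable {P : Measure Ω} {𝓕 : Filtration I mΩ} {X J : I → Ω → ℕ}
  {θ : I → Ω → ℝ≥0} {K : ℝ} {ξ ξ' : I → Ω → ℝ}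

theorem measurable_uncurry (h : IsIntensity P 𝓕 J θ) : Measurable fun z : Ω × I => θ z.2 z.1 :=
  (h.predictable.measurable.mono (predictable_le 𝓕) le_rfl).comp measurable_swap

theorem lintegral_prod_eq (h : IsIntensity P 𝓕 J θ) (hX : IsCountingProcess P X)
    (hJ : IsJumpPart X J) (hξ : IsLeftLimit 𝓕 K ξ ξ') (h0 : ∀ s ω, 0 ≤ ξ' s ω) :
    ∫⁻ z : Ω × I, ENNReal.ofReal (ξ' z.2 z.1 * θ z.2 z.1) ∂(P.prod volume)
      = ∫⁻ ω, ENNReal.ofReal (∑' s : I, ξ' s ω * (J s ω : ℝ)) ∂P := by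
  have hC : IsStronglyPredictable 𝓕 fun s ω => ENNReal.ofReal (ξ' s ω) := by
    have := hξ.measurable_predictable.ennreal_ofReal
    exact this.stronglyMeasurable
  have hm : Measurable fun z : Ω × I => ξ' z.2 z.1 * (θ z.2 z.1 : ℝ) :=
    hξ.measurable_uncurry.mul h.measurable_uncurry.coe_nnreal_real
  rw [lintegral_prod _ hm.ennreal_ofReal.aemeasurable]
  simp_rw [← hX.ofReal_tsum hJ (fun s => h0 s _)]
  rw [h.projection _ hC]
  simp_rw [ENNReal.ofReal_mul (h0 _ _), ENNReal.ofReal_coe_nnreal]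

/-- The compensation formula for a bounded integrand of constant sign. -/
theorem integral_prod_eq_of_nonneg (h : IsIntensity P 𝓕 J θ) (hX : IsCountingProcess P X)
    (hJ : IsJumpPart X J) (hξ : IsLeftLimit 𝓕 K ξ ξ') (h0 : ∀ s ω, 0 ≤ ξ' s ω) :
    Integrable (fun z : Ω × I => ξ' z.2 z.1 * θ z.2 z.1) (P.prod volume) ∧
      ∫ z : Ω × I, ξ' z.2 z.1 * θ z.2 z.1 ∂(P.prod volume)
        = ∫ ω, ∑' s : I, ξ' s ω * (J s ω : ℝ) ∂P := by
  have hm : Measurable fun z : Ω × I => ξ' z.2 z.1 * (θ z.2 z.1 : ℝ) :=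
    hξ.measurable_uncurry.mul h.measurable_uncurry.coe_nnreal_real
  have hn : ∀ z : Ω × I, 0 ≤ ξ' z.2 z.1 * (θ z.2 z.1 : ℝ) := fun z =>
    mul_nonneg (h0 _ _) (NNReal.coe_nonneg _)
  have hs : ∀ ω, 0 ≤ ∑' s : I, ξ' s ω * (J s ω : ℝ) := fun ω =>
    tsum_nonneg fun s => mul_nonneg (h0 _ _) (Nat.cast_nonneg _)
  have key := h.lintegral_prod_eq hX hJ hξ h0
  have hint := hX.integrable_tsum hJ hξ
  constructor
  · refine ⟨hm.aestronglyMeasurable, ?_⟩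
    rw [hasFiniteIntegral_iff_ofReal (.of_forall hn), key]
    exact (hasFiniteIntegral_iff_ofReal (.of_forall hs)).1 hint.2
  · rw [integral_eq_lintegral_of_nonneg_ae (.of_forall hn) hm.aestronglyMeasurable, key,
      integral_eq_lintegral_of_nonneg_ae (.of_forall hs) hint.1]

/-- The compensation formula for a bounded process of left limits. -/
theorem integral_prod_eq (h : IsIntensity P 𝓕 J θ) (hX : IsCountingProcess P X)
    (hJ : IsJumpPart X J) (hξ : IsLeftLimit 𝓕 K ξ ξ') :
    Integrable (fun z : Ω × I => ξ' z.2 z.1 * θ z.2 z.1) (P.prod volume) ∧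
      ∫ z : Ω × I, ξ' z.2 z.1 * θ z.2 z.1 ∂(P.prod volume)
        = ∫ ω, ∑' s : I, ξ' s ω * (J s ω : ℝ) ∂P := by
  have h1 := h.integral_prod_eq_of_nonneg hX hJ hξ.posPart fun _ _ => le_max_right _ _
  have h2 := h.integral_prod_eq_of_nonneg hX hJ hξ.neg.posPart fun _ _ => le_max_right _ _
  have e : ∀ x : ℝ, x = max x 0 - max (-x) 0 := fun x => by
    rcases le_total 0 x with hx | hx
    · rw [max_eq_left hx, max_eq_right (neg_nonpos.2 hx), sub_zero]
    · rw [max_eq_right hx, max_eq_left (neg_nonneg.2 hx), zero_sub, neg_neg]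
  have e1 : (fun z : Ω × I => ξ' z.2 z.1 * (θ z.2 z.1 : ℝ)) = fun z =>
      max (ξ' z.2 z.1) 0 * (θ z.2 z.1 : ℝ) - max (-ξ' z.2 z.1) 0 * (θ z.2 z.1 : ℝ) := by
    funext z
    rw [← sub_mul, ← e]
  have e2 : ∀ ω, ∑' s : I, ξ' s ω * (J s ω : ℝ)
      = ∑' s : I, max (ξ' s ω) 0 * (J s ω : ℝ) - ∑' s : I, max (-ξ' s ω) 0 * (J s ω : ℝ) := by
    intro ω
    have hfin := (hX.path ω).finite_support_jump
    have hmem : ∀ t, jump (fun t => X t ω) t ≠ 0 → t ∈ hfin.toFinset := by simp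
    rw [hJ.tsum_mul_eq _ hmem, hJ.tsum_mul_eq _ hmem,
      hJ.tsum_mul_eq _ hmem, ← Finset.sum_sub_distrib]
    refine Finset.sum_congr rfl fun s _ => ?_
    rw [← sub_mul, ← e]
  simp_rw [e2]
  rw [e1]
  refine ⟨h1.1.sub h2.1, ?_⟩
  rw [integral_sub h1.1 h2.1, integral_sub (hX.integrable_tsum hJ hξ.posPart)
    (hX.integrable_tsum hJ hξ.neg.posPart), h1.2, h2.2]

end IsIntensity

/-! ### Independence of σ-algebras -/

/-- If `m₁` is independent of `m₂` and both together are independent of `m₃`, then `m₁` is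
independent of `m₂` and `m₃` together. -/
theorem indep_sup_right {P : Measure Ω} [IsProbabilityMeasure P] {m₁ m₂ m₃ : MeasurableSpace Ω}
    (h₁ : m₁ ≤ mΩ) (h₂ : m₂ ≤ mΩ) (h₃ : m₃ ≤ mΩ) (h12 : Indep m₁ m₂ P)
    (h123 : Indep (m₁ ⊔ m₂) m₃ P) : Indep m₁ (m₂ ⊔ m₃) P := by
  set p : Set (Set Ω) := {A | ∃ B C, MeasurableSet[m₂] B ∧ MeasurableSet[m₃] C ∧ A = B ∩ C}
    with hp
  have hgen : m₂ ⊔ m₃ = MeasurableSpace.generateFrom p := by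
    apply le_antisymm
    · refine sup_le (fun B hB => ?_) (fun C hC => ?_)
      · exact MeasurableSpace.measurableSet_generateFrom
          ⟨B, univ, hB, MeasurableSet.univ, (inter_univ B).symm⟩
      · exact MeasurableSpace.measurableSet_generateFrom
          ⟨univ, C, MeasurableSet.univ, hC, (univ_inter C).symm⟩
    · refine MeasurableSpace.generateFrom_le ?_
      rintro _ ⟨B, C, hB, hC, rfl⟩
      exact MeasurableSet.inter ((le_sup_left : m₂ ≤ m₂ ⊔ m₃) B hB)
        ((le_sup_right : m₃ ≤ m₂ ⊔ m₃) C hC)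
  refine IndepSets.indep h₁ (sup_le h₂ h₃) (@MeasurableSpace.isPiSystem_measurableSet Ω m₁) ?_
    (@MeasurableSpace.generateFrom_measurableSet Ω m₁).symm hgen ?_
  · rintro _ ⟨B, C, hB, hC, rfl⟩ _ ⟨B', C', hB', hC', rfl⟩ -
    exact ⟨B ∩ B', C ∩ C', hB.inter hB', hC.inter hC', by rw [inter_inter_inter_comm]⟩
  · rw [IndepSets_iff]
    rintro A _ hA ⟨B, C, hB, hC, rfl⟩
    rw [Indep_iff] at h12 h123
    have hA' : MeasurableSet[m₁ ⊔ m₂] A := (le_sup_left : m₁ ≤ m₁ ⊔ m₂) A hA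
    have hB' : MeasurableSet[m₁ ⊔ m₂] B := (le_sup_right : m₂ ≤ m₁ ⊔ m₂) B hB
    rw [← inter_assoc, h123 _ _ (hA'.inter hB') hC, h12 _ _ hA hB, h123 _ _ hB' hC, mul_assoc]

/-- Every event in the σ-algebra of the null events has probability `0` or `1`, so that this
σ-algebra is independent of every other one. -/
theorem indep_nullSigma {P : Measure Ω} [IsProbabilityMeasure P] {m : MeasurableSpace Ω}
    (hm : m ≤ mΩ) : Indep m (@nullSigma Ω mΩ P) P := by
  have h2 : @nullSigma Ω mΩ P =
      MeasurableSpace.generateFrom {A | MeasurableSet[mΩ] A ∧ P A = 0} := rfl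
  refine IndepSets.indep hm (@nullSigma_le Ω mΩ P)
    (@MeasurableSpace.isPiSystem_measurableSet Ω m) ?_
    (@MeasurableSpace.generateFrom_measurableSet Ω m).symm h2 ?_
  · rintro A ⟨hA, hA0⟩ B ⟨hB, -⟩ -
    exact ⟨@MeasurableSet.inter Ω mΩ _ _ hA hB, measure_mono_null inter_subset_left hA0⟩
  · rw [IndepSets_iff]
    rintro A B - ⟨-, hB⟩
    rw [hB, mul_zero]
    exact measure_mono_null inter_subset_right hB

/-- The increments of a process with independent increments, started at `0`, are independent of
the past. -/
theorem indep_increment_past {P : Measure Ω} [IsProbabilityMeasure P] {X : I → Ω → ℕ}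
    (hX : HasIndepIncrements X P) (hm : ∀ t, Measurable (X t)) (h0 : ∀ ω, X 0 ω = 0)
    (hmono : ∀ ω, Monotone fun t => X t ω) {r u : I} (hru : r ≤ u) :
    Indep (MeasurableSpace.comap (fun ω => X u ω - X r ω) inferInstance)
      (⨆ s ≤ r, MeasurableSpace.comap (X s) inferInstance) P := by
  classical
  have hle : ∀ s, MeasurableSpace.comap (X s) inferInstance ≤ mΩ := fun s => (hm s).comap_le
  -- The past is the directed supremum of the σ-algebras of finitely many times.
  set m : Finset (Iic r) → MeasurableSpace Ω :=
    fun S => ⨆ s ∈ S, MeasurableSpace.comap (X s) inferInstance with hmdef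
  have hsup : (⨆ s ≤ r, MeasurableSpace.comap (X s) inferInstance) = ⨆ S, m S := by
    apply le_antisymm
    · refine iSup₂_le fun s hs => le_iSup_of_le {⟨s, hs⟩} ?_
      exact le_iSup₂_of_le (⟨s, hs⟩ : Iic r) (Finset.mem_singleton_self _) le_rfl
    · exact iSup_le fun S => iSup₂_le fun s _ => le_iSup₂_of_le (s : I) s.2 le_rfl
  rw [hsup]
  refine (indep_iSup_of_monotone (m := m) (fun S => ?_) (fun S => iSup₂_le fun s _ => hle s)
    (((hm u).sub (hm r)).comap_le)
    (fun S T hST => biSup_mono fun _ hs => Finset.mem_of_subset hST hs)).symm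
  -- The times of `S`, with `0` and `r` added, in increasing order; they are continued by `u`.
  set l : List I := ((insert 0 (insert r (S.map ⟨Subtype.val, Subtype.val_injective⟩))).sort
    (· ≤ ·)) with hl
  have hmem : ∀ s, s ∈ l ↔ s = 0 ∨ s = r ∨ ∃ h : s ≤ r, (⟨s, h⟩ : Iic r) ∈ S := by
    intro s
    rw [hl, Finset.mem_sort]
    simp
  have hsorted : l.Pairwise (· ≤ ·) := Finset.pairwise_sort _ _
  have hler : ∀ s ∈ l, s ≤ r := by
    intro s hs
    rcases (hmem s).1 hs with rfl | rfl | ⟨h, -⟩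
    exacts [bot_le, le_rfl, h]
  have hlpos : 0 < l.length := List.length_pos_of_mem ((hmem r).2 (Or.inr (Or.inl rfl)))
  set t : ℕ → I := fun i => l.getD i u with ht
  have htlt : ∀ i (h : i < l.length), t i = l[i] := fun i h => List.getD_eq_getElem _ _ h
  have htge : ∀ i, l.length ≤ i → t i = u := fun i h => List.getD_eq_default _ _ h
  have hmonot : Monotone t := by
    intro i j hij
    rcases lt_or_ge j l.length with hj | hj
    · rw [htlt i (hij.trans_lt hj), htlt j hj]
      rcases eq_or_lt_of_le hij with rfl | hij
      · exact le_rfl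
      · exact List.pairwise_iff_getElem.1 hsorted i j _ hj hij
    · rw [htge j hj]
      rcases lt_or_ge i l.length with hi | hi
      · rw [htlt i hi]
        exact (hler _ (List.getElem_mem hi)).trans hru
      · rw [htge i hi]
  have hindex : ∀ s ∈ l, ∃ i < l.length, t i = s := by
    intro s hs
    obtain ⟨i, hi, rfl⟩ := List.getElem_of_mem hs
    exact ⟨i, hi, htlt i hi⟩
  have ht0 : t 0 = 0 := by
    obtain ⟨i, hi, h⟩ := hindex 0 ((hmem 0).2 (Or.inl rfl))
    exact le_antisymm (h ▸ hmonot (Nat.zero_le i)) bot_le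
  have htlast : t (l.length - 1) = r := by
    obtain ⟨i, hi, h⟩ := hindex r ((hmem r).2 (Or.inr (Or.inl rfl)))
    apply le_antisymm
    · rw [htlt _ (by omega)]
      exact hler _ (List.getElem_mem _)
    · rw [← h]
      exact hmonot (by omega)
  have hind := hX.nat hmonot
  have hmeas : ∀ i, Measurable fun ω => X (t (i + 1)) ω - X (t i) ω := fun i =>
    (hm _).sub (hm _)
  have key := hind.indepFun_finset (Finset.range (l.length - 1)) {l.length - 1} (by simp) hmeas
  have h1 : MeasurableSpace.comap (fun ω => X u ω - X r ω) inferInstance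
      ≤ MeasurableSpace.comap (fun ω (i : ({l.length - 1} : Finset ℕ)) =>
          X (t (i + 1)) ω - X (t i) ω) inferInstance := by
    rw [← measurable_iff_comap_le]
    have : (fun ω => X u ω - X r ω) = (fun x : ({l.length - 1} : Finset ℕ) → ℕ =>
        x ⟨l.length - 1, Finset.mem_singleton_self _⟩) ∘ (fun ω
          (i : ({l.length - 1} : Finset ℕ)) => X (t (i + 1)) ω - X (t i) ω) := by
      funext ω
      simp only [Function.comp]
      rw [htlast, htge (l.length - 1 + 1) (by omega)]
    rw [this]
    exact (measurable_pi_apply _).comp (comap_measurable _)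
  have h2 : m S ≤ MeasurableSpace.comap (fun ω (i : (Finset.range (l.length - 1))) =>
          X (t (i + 1)) ω - X (t i) ω) inferInstance := by
    refine iSup₂_le fun s hs => ?_
    obtain ⟨j, hj, hjs⟩ := hindex s ((hmem s).2 (Or.inr (Or.inr ⟨s.2, hs⟩)))
    rw [← measurable_iff_comap_le]
    have hsum : ∀ k ≤ l.length - 1, Measurable[MeasurableSpace.comap
        (fun ω (i : (Finset.range (l.length - 1))) => X (t (i + 1)) ω - X (t i) ω)
        inferInstance] (X (t k)) := by
      intro k
      induction k with
      | zero =>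
        intro _
        have : X (t 0) = fun _ => 0 := by
          funext ω
          rw [ht0, h0]
        rw [this]
        exact measurable_const
      | succ k ih =>
        intro hk
        have h3 : X (t (k + 1)) = fun ω => X (t k) ω + (X (t (k + 1)) ω - X (t k) ω) := by
          funext ω
          exact (Nat.add_sub_cancel' (hmono ω (hmonot k.le_succ))).symm
        rw [h3]
        refine (ih (by omega)).add ?_
        exact (measurable_pi_apply (⟨k, Finset.mem_range.2 (by omega)⟩ :
          Finset.range (l.length - 1))).comp (comap_measurable (fun ω
            (i : (Finset.range (l.length - 1))) => X (t (i + 1)) ω - X (t i) ω))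
    rw [← hjs]
    exact hsum j (by omega)
  exact indep_of_indep_of_le_left (indep_of_indep_of_le_right key h1) h2

/-! ### Poisson processes -/

theorem hasSum_poisson_mean (r : ℝ≥0) :
    HasSum (fun n : ℕ => Real.exp (-r) * (r : ℝ) ^ n / (n.factorial : ℝ) * n) r := by
  rw [← hasSum_nat_add_iff' 1]
  have h := (hasSum_one_poissonMeasure r).mul_left (r : ℝ)
  rw [mul_one] at h
  simp only [Finset.range_one, Finset.sum_singleton, Nat.cast_zero, mul_zero, sub_zero]
  refine h.congr_fun fun n => ?_
  rw [Nat.factorial_succ]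
  push_cast
  have : ((n : ℝ) + 1) ≠ 0 := by positivity
  have : (n.factorial : ℝ) ≠ 0 := by positivity
  field_simp
  ring

theorem integrable_poissonMeasure_id (r : ℝ≥0) :
    Integrable (fun n : ℕ => (n : ℝ)) (poissonMeasure r) := by
  rw [integrable_poissonMeasure_iff]
  simpa using (hasSum_poisson_mean r).summable

theorem integral_poissonMeasure_id (r : ℝ≥0) : ∫ n : ℕ, (n : ℝ) ∂(poissonMeasure r) = r := by
  rw [integral_poissonMeasure]
  simpa using (hasSum_poisson_mean r).tsum_eq

namespace IsPoissonProcess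

variable {P : Measure Ω} {X : I → Ω → ℕ} {β : ℝ≥0}

theorem cast_sub (h : IsPoissonProcess X β P) {s t : I} (hst : s ≤ t) (ω : Ω) :
    (((X t - X s) ω : ℕ) : ℝ) = (X t ω : ℝ) - X s ω :=
  Nat.cast_sub ((h.path ω).mono hst)

theorem integrable_sub (h : IsPoissonProcess X β P) {s t : I} (hst : s ≤ t) :
    Integrable (fun ω => (X t ω : ℝ) - X s ω) P := by
  simp_rw [← h.cast_sub hst]
  have h1 := integrable_poissonMeasure_id (β * Real.toNNReal ((t : ℝ) - (s : ℝ)))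
  rw [← h.law s t hst] at h1
  exact h1.comp_measurable ((h.measurable t).sub (h.measurable s))

theorem integral_sub (h : IsPoissonProcess X β P) {s t : I} (hst : s ≤ t) :
    ∫ ω, ((X t ω : ℝ) - X s ω) ∂P = β * ((t : ℝ) - s) := by
  simp_rw [← h.cast_sub hst]
  rw [← integral_map (φ := X t - X s) (f := fun n : ℕ => (n : ℝ))
    ((h.measurable t).sub (h.measurable s)).aemeasurable (by fun_prop), h.law s t hst,
    integral_poissonMeasure_id]
  push_cast
  rw [Real.coe_toNNReal _ (sub_nonneg.2 hst)]

theorem isCountingProcess (h : IsPoissonProcess X β P) : IsCountingProcess P X where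
  path := h.path
  measurable := h.measurable
  integrable := by
    have := h.integrable_sub (s := 0) (t := 1) bot_le
    simpa [(h.path _).zero] using this

end IsPoissonProcess

/-! ### Compensation of the noise orders -/

/-- The counting process `X` has the compensator `β t` relative to `𝓕`: its increments have mean
`β (u - s)` under every bounded weight that is known at time `s`. -/
structure IsCompensated (P : Measure Ω) (𝓕 : Filtration I mΩ) (β : ℝ≥0) (X : I → Ω → ℕ) : Prop
    extends IsCountingProcess P X where
  integral_mul_sub : ∀ (s u : I), s ≤ u → ∀ (K : ℝ) (ξ : Ω → ℝ), Measurable[𝓕 s] ξ →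
    (∀ ω, |ξ ω| ≤ K) → ∫ ω, ξ ω * ((X u ω : ℝ) - X s ω) ∂P = β * ((u : ℝ) - s) * ∫ ω, ξ ω ∂P

theorem IsPoissonProcess.isCompensated_augmentation {P : Measure Ω} [IsProbabilityMeasure P]
    {X : I → Ω → ℕ} {β : ℝ≥0} (hX : IsPoissonProcess X β P) {𝓖 : Filtration I mΩ}
    (hind : ∀ r u : I, r ≤ u → Indep (MeasurableSpace.comap (fun ω => X u ω - X r ω) inferInstance)
      (𝓖 r) P) : IsCompensated P (augmentation P 𝓖) β X where
  toIsCountingProcess := hX.isCountingProcess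
  integral_mul_sub s u hsu K ξ hξ hK := by
    rcases eq_or_lt_of_le hsu with rfl | hsu
    · simp
    have hle : ∀ r, 𝓖 r ⊔ nullSigma P ≤ mΩ := fun r => sup_le (𝓖.le r) (nullSigma_le P)
    have hξ0 : Measurable ξ := hξ.mono ((augmentation P 𝓖).le s) le_rfl
    have hξr : ∀ r > s, Measurable[𝓖 r ⊔ nullSigma P] ξ := by
      intro r hr
      refine hξ.mono ?_ le_rfl
      rw [augmentation, Filtration.rightCont_eq_of_not_isMax _ (not_isMax_of_lt hsu)]
      exact iInf₂_le r hr
    -- At times `r > s` the weight is known without the right-continuous enlargement.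
    have key : ∀ r > s, r ≤ u →
        ∫ ω, ξ ω * ((X u ω : ℝ) - X r ω) ∂P = (∫ ω, ξ ω ∂P) * (β * ((u : ℝ) - r)) := by
      intro r hr hru
      have hm1 : Measurable fun ω => X u ω - X r ω := (hX.measurable u).sub (hX.measurable r)
      have h1 : Indep (MeasurableSpace.comap (fun ω => X u ω - X r ω) inferInstance)
          (𝓖 r ⊔ nullSigma P) P :=
        indep_sup_right hm1.comap_le (𝓖.le r) (nullSigma_le P) (hind r u hru)
          (indep_nullSigma (sup_le hm1.comap_le (𝓖.le r)))
      have h2 : IndepFun ξ (fun ω => X u ω - X r ω) P :=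
        indep_of_indep_of_le_left h1.symm (hξr r hr).comap_le
      have h3 : IndepFun ξ (fun ω => ((X u ω - X r ω : ℕ) : ℝ)) P :=
        h2.comp (φ := id) (ψ := fun n : ℕ => (n : ℝ)) measurable_id .of_discrete
      have h4 : ∀ ω, ((X u ω - X r ω : ℕ) : ℝ) = (X u ω : ℝ) - X r ω := hX.cast_sub hru
      simp_rw [h4] at h3
      rw [← hX.integral_sub hru]
      exact h3.integral_fun_mul_eq_mul_integral hξ0.aestronglyMeasurable
        (hX.integrable_sub hru).aestronglyMeasurable
    obtain ⟨r, -, hr, hrs⟩ := exists_seq_strictAnti_tendsto' hsu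
    have hr' : Tendsto r atTop (𝓝[>] s) :=
      tendsto_nhdsWithin_iff.2 ⟨hrs, .of_forall fun n => (hr n).1⟩
    have hX' : ∀ t, Measurable fun ω => (X t ω : ℝ) := fun t =>
      measurable_from_top.comp (hX.measurable t)
    have l1 : Tendsto (fun n => ∫ ω, ξ ω * ((X u ω : ℝ) - X (r n) ω) ∂P) atTop
        (𝓝 (∫ ω, ξ ω * ((X u ω : ℝ) - X s ω) ∂P)) := by
      refine tendsto_integral_of_dominated_convergence (fun ω => K * (X 1 ω : ℝ))
        (fun n => (hξ0.mul ((hX' _).sub (hX' _))).aestronglyMeasurable)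
        (hX.isCountingProcess.integrable.const_mul K) (fun n => .of_forall fun ω => ?_)
        (.of_forall fun ω => ?_)
      · have h1 : (X (r n) ω : ℝ) ≤ X u ω := Nat.cast_le.2 ((hX.path ω).mono (hr n).2.le)
        have h2 : (X u ω : ℝ) ≤ X 1 ω := Nat.cast_le.2 ((hX.path ω).mono le_top)
        rw [Real.norm_eq_abs, abs_mul, abs_of_nonneg (sub_nonneg.2 h1)]
        exact mul_le_mul (hK ω) ((sub_le_self _ (Nat.cast_nonneg _)).trans h2)
          (sub_nonneg.2 h1) ((abs_nonneg _).trans (hK ω))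
      · refine Tendsto.const_mul _ (tendsto_const_nhds.congr' ?_)
        filter_upwards [hr'.eventually ((hX.path ω).isStepPath.right s)] with n hn
        rw [hn]
    have l2 : Tendsto (fun n => (∫ ω, ξ ω ∂P) * (β * ((u : ℝ) - r n))) atTop
        (𝓝 ((∫ ω, ξ ω ∂P) * (β * ((u : ℝ) - s)))) :=
      (((continuous_subtype_val.tendsto s).comp hrs).const_sub _).const_mul _ |>.const_mul _
    rw [tendsto_nhds_unique (l1.congr fun n => key (r n) (hr n).1 (hr n).2.le) l2]
    ring

/-- The compensation formula: noise orders arrive at rate `β`. -/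
theorem IsCompensated.integral_tsum_eq {P : Measure Ω} [IsProbabilityMeasure P]
    {𝓕 : Filtration I mΩ} {β : ℝ≥0} {X : I → Ω → ℕ} (hX : IsCompensated P 𝓕 β X) {K : ℝ}
    {ξ ξ' : I → Ω → ℝ} (hξ : IsLeftLimit 𝓕 K ξ ξ') :
    ∫ ω, ∑' s : I, ξ' s ω * (jump (fun t => X t ω) s : ℝ) ∂P
      = β * ∫ z : Ω × I, ξ' z.2 z.1 ∂(P.prod volume) := by
  have hξm : ∀ t, Measurable (ξ t) := fun t => (hξ.measurable t).mono (𝓕.le t) le_rfl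
  have hXm : ∀ t, Measurable fun ω => (X t ω : ℝ) := fun t =>
    measurable_from_top.comp (hX.measurable t)
  have hmono : ∀ n k ω, (0 : ℝ) ≤ (X (grid n (k + 1)) ω : ℝ) - X (grid n k) ω := fun n k ω =>
    sub_nonneg.2 (Nat.cast_le.2 ((hX.path ω).mono (grid_mono n k.le_succ)))
  have hterm : ∀ n k, Integrable (fun ω =>
      ξ (grid n k) ω * ((X (grid n (k + 1)) ω : ℝ) - X (grid n k) ω)) P := by
    intro n k
    refine (hX.integrable.const_mul K).mono'
      ((hξm _).mul ((hXm _).sub (hXm _))).aestronglyMeasurable (.of_forall fun ω => ?_)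
    rw [Real.norm_eq_abs, abs_mul, abs_of_nonneg (hmono n k ω)]
    refine mul_le_mul (hξ.bound _ ω) ((sub_le_self _ (Nat.cast_nonneg _)).trans
      (Nat.cast_le.2 ((hX.path ω).mono le_top))) (hmono n k ω)
      ((abs_nonneg _).trans (hξ.bound 0 ω))
  have l1 : Tendsto (fun n => ∫ ω, ∑ k ∈ Finset.range (n + 1),
      ξ (grid n k) ω * ((X (grid n (k + 1)) ω : ℝ) - X (grid n k) ω) ∂P) atTop
      (𝓝 (∫ ω, ∑' s : I, ξ' s ω * (jump (fun t => X t ω) s : ℝ) ∂P)) := by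
    refine tendsto_integral_of_dominated_convergence (fun ω => K * (X 1 ω : ℝ))
      (fun n => (integrable_finsetSum _ fun k _ => hterm n k).aestronglyMeasurable)
      (hX.integrable.const_mul K) (fun n => .of_forall fun ω => ?_) (.of_forall fun ω => ?_)
    · have hfin := (hX.path ω).finite_support_jump
      have hmem : ∀ t, jump (fun t => X t ω) t ≠ 0 → t ∈ hfin.toFinset := by simp
      rw [(hX.path ω).sum_grid _ hmem n fun k => ξ (grid n k) ω, Real.norm_eq_abs,
        ← (hX.path ω).sum_jump _ hmem, Finset.mul_sum]
      refine (Finset.abs_sum_le_sum_abs _ _).trans (Finset.sum_le_sum fun s _ => ?_)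
      rw [abs_mul, Nat.abs_cast]
      exact mul_le_mul_of_nonneg_right (hξ.bound _ ω) (Nat.cast_nonneg _)
    · have hfin := (hX.path ω).finite_support_jump
      have hmem : ∀ t, jump (fun t => X t ω) t ≠ 0 → t ∈ hfin.toFinset := by simp
      rw [tsum_eq_sum (s := hfin.toFinset) (fun t ht => by
        rw [not_imp_comm.1 (hmem t) ht, Nat.cast_zero, mul_zero])]
      simp_rw [fun n => (hX.path ω).sum_grid _ hmem n fun k => ξ (grid n k) ω]
      refine tendsto_finsetSum _ fun s hs => Tendsto.mul_const _ ?_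
      refine (hξ.left ω s).comp (tendsto_grid_gridIdx ?_)
      rcases eq_or_lt_of_le (show (0 : I) ≤ s from bot_le) with h0 | h0
      · rw [← h0] at hs
        simp [(hX.path ω).jump_zero] at hs
      · exact h0
  have hind : ∀ n k, Measurable fun z : Ω × I =>
      (Ioc (grid n k) (grid n (k + 1))).indicator (fun _ => ξ (grid n k) z.1) z.2 := by
    intro n k
    have : (fun z : Ω × I =>
        (Ioc (grid n k) (grid n (k + 1))).indicator (fun _ => ξ (grid n k) z.1) z.2)
        = (univ ×ˢ Ioc (grid n k) (grid n (k + 1))).indicator fun z => ξ (grid n k) z.1 := by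
      funext z
      simp [indicator]
    rw [this]
    exact ((hξm _).comp measurable_fst).indicator (MeasurableSet.univ.prod measurableSet_Ioc)
  have hsumle : ∀ n (z : Ω × I), |∑ k ∈ Finset.range (n + 1),
      (Ioc (grid n k) (grid n (k + 1))).indicator (fun _ => ξ (grid n k) z.1) z.2| ≤ K := by
    intro n z
    rcases eq_or_lt_of_le (show (0 : I) ≤ z.2 from bot_le) with h0 | h0
    · rw [Finset.sum_eq_zero fun k _ => indicator_of_notMem
        (fun hk => not_lt_bot (h0 ▸ hk.1)) _, abs_zero]
      exact (abs_nonneg _).trans (hξ.bound 0 z.1)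
    · rw [Finset.sum_eq_single_of_mem (gridIdx n z.2) (Finset.mem_range.2 (gridIdx_lt z.2)),
        indicator_of_mem (mem_Ioc_gridIdx h0)]
      · exact hξ.bound _ _
      · intro k hk hne
        refine indicator_of_notMem (fun hm => hne ?_) _
        exact ((mem_Ioc_grid_iff (Finset.mem_range.1 hk) z.2).1 hm).2
  have hle1 : ∀ n k (z : Ω × I),
      ‖(Ioc (grid n k) (grid n (k + 1))).indicator (fun _ => ξ (grid n k) z.1) z.2‖ ≤ K :=
    fun n k z => (norm_indicator_le_norm_self _ _).trans (hξ.bound _ _)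
  have l2 : Tendsto (fun n => ∫ z : Ω × I, ∑ k ∈ Finset.range (n + 1),
      (Ioc (grid n k) (grid n (k + 1))).indicator (fun _ => ξ (grid n k) z.1) z.2
        ∂(P.prod volume)) atTop (𝓝 (∫ z : Ω × I, ξ' z.2 z.1 ∂(P.prod volume))) := by
    refine tendsto_integral_of_dominated_convergence (fun _ => K)
      (fun n => (Finset.measurable_sum _ fun k _ => hind n k).aestronglyMeasurable)
      (integrable_const K) (fun n => .of_forall fun z => hsumle n z)
      (.of_forall fun z => hξ.tendsto_sum_grid z.2 z.1)
  refine tendsto_nhds_unique l1 ((l2.const_mul (β : ℝ)).congr fun n => ?_)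
  rw [integral_finsetSum _ fun k _ => hterm n k, integral_finsetSum _ fun k _ =>
    Integrable.mono' (integrable_const K) (hind n k).aestronglyMeasurable
      (.of_forall fun z => hle1 n k z), Finset.mul_sum]
  refine Finset.sum_congr rfl fun k _ => ?_
  rw [hX.integral_mul_sub _ _ (grid_mono n k.le_succ) K _ (hξ.measurable _) (hξ.bound _)]
  have e : ∀ z : Ω × I, (Ioc (grid n k) (grid n (k + 1))).indicator
      (fun _ => ξ (grid n k) z.1) z.2
      = ξ (grid n k) z.1 * (Ioc (grid n k) (grid n (k + 1))).indicator (fun _ => (1 : ℝ)) z.2 := by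
    intro z
    simp [indicator]
  simp_rw [e]
  rw [integral_prod_mul (ξ (grid n k))
    ((Ioc (grid n k) (grid n (k + 1))).indicator fun _ => (1 : ℝ)),
    integral_indicator_const _ measurableSet_Ioc, Measure.real, unitInterval.volume_Ioc,
    ENNReal.toReal_ofReal (sub_nonneg.2 (grid_mono n k.le_succ)), smul_eq_mul, mul_one]
  ring

/-- Independent Poisson processes almost surely have no common jump: a partition of the time
interval into `n + 1` parts bounds the expected number of common jumps by `β ^ 2 / (n + 1)`. -/
theorem ae_no_common_jump {P : Measure Ω} [IsProbabilityMeasure P] {X W : I → Ω → ℕ} {β : ℝ≥0}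
    (hX : IsPoissonProcess X β P) (hW : IsPoissonProcess W β P)
    (hind : IndepFun (fun ω t => X t ω) (fun ω t => W t ω) P) :
    ∀ᵐ ω ∂P, ∀ s, jump (fun t => X t ω) s = 0 ∨ jump (fun t => W t ω) s = 0 := by
  have hXm : ∀ t, Measurable fun ω => (X t ω : ℝ) := fun t =>
    measurable_from_top.comp (hX.measurable t)
  have hWm : ∀ t, Measurable fun ω => (W t ω : ℝ) := fun t =>
    measurable_from_top.comp (hW.measurable t)
  set L : Ω → ℝ := fun ω => ∑' s : I, (jump (fun t => W t ω) s : ℝ) * jump (fun t => X t ω) s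
    with hL
  have hLm : Measurable L := hX.isCountingProcess.measurable_tsum_mul_jump
    (IsGridLimit.jump hW.path hW.measurable hW.path hW.measurable fun a _ => (a : ℝ))
  have hL0 : ∀ ω, 0 ≤ L ω := fun ω => tsum_nonneg fun s =>
    mul_nonneg (Nat.cast_nonneg _) (Nat.cast_nonneg _)
  have hindk : ∀ n k, IndepFun (fun ω => (W (grid n (k + 1)) ω : ℝ) - W (grid n k) ω)
      (fun ω => (X (grid n (k + 1)) ω : ℝ) - X (grid n k) ω) P := by
    intro n k
    have hφ : Measurable fun x : I → ℕ => (x (grid n (k + 1)) : ℝ) - x (grid n k) :=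
      (measurable_from_top.comp (measurable_pi_apply _)).sub
        (measurable_from_top.comp (measurable_pi_apply _))
    exact hind.symm.comp hφ hφ
  have hgi : ∀ n k, Integrable (fun ω => ((W (grid n (k + 1)) ω : ℝ) - W (grid n k) ω) *
      ((X (grid n (k + 1)) ω : ℝ) - X (grid n k) ω)) P := fun n k =>
    (hindk n k).integrable_mul (hW.integrable_sub (grid_mono n k.le_succ))
      (hX.integrable_sub (grid_mono n k.le_succ))
  have hfinm : ∀ ω, ∀ t, jump (fun t => X t ω) t ≠ 0 →
      t ∈ (hX.path ω).finite_support_jump.toFinset := by simp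
  have hLle : ∀ n ω, L ω ≤ ∑ k ∈ Finset.range (n + 1),
      ((W (grid n (k + 1)) ω : ℝ) - W (grid n k) ω) *
        ((X (grid n (k + 1)) ω : ℝ) - X (grid n k) ω) := by
    intro n ω
    rw [(hX.path ω).sum_grid _ (hfinm ω) n fun k =>
      (W (grid n (k + 1)) ω : ℝ) - W (grid n k) ω, hL]
    simp only
    rw [tsum_eq_sum (s := (hX.path ω).finite_support_jump.toFinset) (fun t ht => by
      rw [not_imp_comm.1 (hfinm ω t) ht, Nat.cast_zero, mul_zero])]
    refine Finset.sum_le_sum fun s hs => mul_le_mul_of_nonneg_right ?_ (Nat.cast_nonneg _)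
    have hs0 : 0 < s := by
      rcases eq_or_lt_of_le (show (0 : I) ≤ s from bot_le) with h0 | h0
      · rw [← h0] at hs
        simp [(hX.path ω).jump_zero] at hs
      · exact h0
    have hmem := mem_Ioc_gridIdx (n := n) hs0
    rw [(hW.path ω).cast_jump]
    exact sub_le_sub (Nat.cast_le.2 ((hW.path ω).mono hmem.2))
      (Nat.cast_le.2 ((hW.path ω).mono.le_leftLim hmem.1))
  have hLi : Integrable L P := by
    refine Integrable.mono' (integrable_finsetSum (Finset.range (0 + 1)) fun k _ => hgi 0 k)
      hLm.aestronglyMeasurable (.of_forall fun ω => ?_)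
    rw [Real.norm_eq_abs, abs_of_nonneg (hL0 ω)]
    exact hLle 0 ω
  have hbound : ∀ n : ℕ, ∫ ω, L ω ∂P ≤ (β : ℝ) ^ 2 * (1 / ((n : ℝ) + 1)) := by
    intro n
    calc ∫ ω, L ω ∂P ≤ ∫ ω, ∑ k ∈ Finset.range (n + 1),
          ((W (grid n (k + 1)) ω : ℝ) - W (grid n k) ω) *
            ((X (grid n (k + 1)) ω : ℝ) - X (grid n k) ω) ∂P :=
          integral_mono hLi (integrable_finsetSum _ fun k _ => hgi n k) (hLle n)
      _ = ∑ k ∈ Finset.range (n + 1), ((β : ℝ) * (1 / ((n : ℝ) + 1))) ^ 2 := by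
          rw [integral_finsetSum _ fun k _ => hgi n k]
          refine Finset.sum_congr rfl fun k hk => ?_
          rw [(hindk n k).integral_fun_mul_eq_mul_integral
            (hW.integrable_sub (grid_mono n k.le_succ)).aestronglyMeasurable
            (hX.integrable_sub (grid_mono n k.le_succ)).aestronglyMeasurable,
            hW.integral_sub (grid_mono n k.le_succ), hX.integral_sub (grid_mono n k.le_succ),
            grid_succ_sub (Finset.mem_range.1 hk), sq]
      _ = (β : ℝ) ^ 2 * (1 / ((n : ℝ) + 1)) := by
          rw [Finset.sum_const, Finset.card_range, nsmul_eq_mul]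
          have : (n : ℝ) + 1 ≠ 0 := by positivity
          push_cast
          field_simp
  have hzero : ∫ ω, L ω ∂P = 0 := by
    refine le_antisymm ?_ (integral_nonneg hL0)
    refine ge_of_tendsto' (x := atTop) (f := fun n : ℕ => (β : ℝ) ^ 2 * (1 / ((n : ℝ) + 1))) ?_
      hbound
    simpa using (tendsto_one_div_add_atTop_nhds_zero_nat (𝕜 := ℝ)).const_mul ((β : ℝ) ^ 2)
  have hae := (integral_eq_zero_iff_of_nonneg hL0 hLi).1 hzero
  filter_upwards [hae] with ω hω s
  by_contra hne
  push Not at hne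
  have hω' : L ω = 0 := hω
  rw [hL] at hω'
  simp only at hω'
  rw [tsum_eq_sum (s := (hX.path ω).finite_support_jump.toFinset) (fun t ht => by
    rw [not_imp_comm.1 (hfinm ω t) ht, Nat.cast_zero, mul_zero]),
    Finset.sum_eq_zero_iff_of_nonneg fun _ _ =>
      mul_nonneg (Nat.cast_nonneg _) (Nat.cast_nonneg _)] at hω'
  have := hω' s (hfinm ω s hne.1)
  rw [mul_eq_zero, Nat.cast_eq_zero, Nat.cast_eq_zero] at this
  tauto

namespace Market

variable {N : ℕ} (M : Market Ω N)

theorem iSup_noiseFiltration :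
    (⨆ t, M.noiseFiltration t) = (⨆ t, MeasurableSpace.comap (M.ZB t) inferInstance) ⊔
      ⨆ t, MeasurableSpace.comap (M.ZS t) inferInstance := by
  rw [← iSup_sup_eq]
  apply le_antisymm
  · refine iSup_le fun t => iSup₂_le fun s _ => ?_
    refine le_trans (le_of_eq ?_) (le_iSup _ s)
    exact MeasurableSpace.comap_prodMk _ _
  · refine iSup_le fun t => le_iSup_of_le t ?_
    refine le_trans (le_of_eq (MeasurableSpace.comap_prodMk (M.ZB t) (M.ZS t)).symm) ?_
    exact le_iSup₂_of_le (f := fun s (_ : s ≤ t) => MeasurableSpace.comap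
      (fun ω => (M.ZB s ω, M.ZS s ω)) inferInstance) t le_rfl le_rfl

/-- Increments of one of the two noise processes, `X`, are independent of the insider's information
before augmentation, even if all of the other noise process `W` is known. -/
theorem indep_increment_insider {X W : I → Ω → ℕ} {𝓗 : Filtration I mΩ}
    (hX : IsPoissonProcess X M.β M.P) (hW : IsPoissonProcess W M.β M.P)
    (hXW : IndepFun (fun ω t => X t ω) (fun ω t => W t ω) M.P)
    (hsup : (⨆ t, M.noiseFiltration t) = (⨆ t, MeasurableSpace.comap (X t) inferInstance) ⊔
      ⨆ t, MeasurableSpace.comap (W t) inferInstance)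
    (hle : ∀ r, M.noiseFiltration r ≤ (⨆ s ≤ r, MeasurableSpace.comap (X s) inferInstance) ⊔
      ⨆ t, MeasurableSpace.comap (W t) inferInstance)
    (h𝓗 : Indep (⨆ t, 𝓗 t) (M.valueSigma ⊔ ⨆ t, M.noiseFiltration t) M.P) (r u : I) (hru : r ≤ u) :
    Indep (MeasurableSpace.comap (fun ω => X u ω - X r ω) inferInstance)
      ((Filtration.const I M.valueSigma M.measurable_value.comap_le ⊔ M.noiseFiltration ⊔ 𝓗 :
        Filtration I mΩ) r) M.P := by
  have := M.isProbabilityMeasure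
  have hXall : (⨆ t, MeasurableSpace.comap (X t) inferInstance) ≤ mΩ :=
    iSup_le fun t => (hX.measurable t).comap_le
  have hWall : (⨆ t, MeasurableSpace.comap (W t) inferInstance) ≤ mΩ :=
    iSup_le fun t => (hW.measurable t).comap_le
  have hpast : (⨆ s ≤ r, MeasurableSpace.comap (X s) inferInstance)
      ≤ ⨆ t, MeasurableSpace.comap (X t) inferInstance := iSup₂_le_iSup _ _
  have hinc : MeasurableSpace.comap (fun ω => X u ω - X r ω) inferInstance
      ≤ ⨆ t, MeasurableSpace.comap (X t) inferInstance := by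
    rw [← measurable_iff_comap_le]
    refine Measurable.sub ?_ ?_
    · exact (comap_measurable (X u)).mono
        (le_iSup (fun t => MeasurableSpace.comap (X t) _) u) le_rfl
    · exact (comap_measurable (X r)).mono
        (le_iSup (fun t => MeasurableSpace.comap (X t) _) r) le_rfl
  have hpi : ∀ V : I → Ω → ℕ, MeasurableSpace.comap (fun ω t => V t ω) MeasurableSpace.pi
      = ⨆ t, MeasurableSpace.comap (V t) inferInstance := by
    intro V
    rw [MeasurableSpace.pi, MeasurableSpace.comap_iSup]
    simp_rw [MeasurableSpace.comap_comp]
    rfl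
  have hXW' : Indep (⨆ t, MeasurableSpace.comap (X t) inferInstance)
      (⨆ t, MeasurableSpace.comap (W t) inferInstance) M.P := by
    rw [← hpi, ← hpi]
    exact hXW
  have hnoise : (⨆ t, M.noiseFiltration t) ≤ mΩ := iSup_le M.noiseFiltration.le
  have hval : Indep (⨆ t, M.noiseFiltration t) M.valueSigma M.P := by
    have h1 := M.indep_value.symm
    have h2 : (⨆ t, M.noiseFiltration t) ≤ MeasurableSpace.comap
        (fun ω t => (M.ZB t ω, M.ZS t ω)) MeasurableSpace.pi := by
      rw [MeasurableSpace.pi, MeasurableSpace.comap_iSup]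
      refine iSup_le fun t => iSup₂_le fun s _ => le_iSup_of_le s ?_
      rw [MeasurableSpace.comap_comp]
      exact le_of_eq rfl
    exact indep_of_indep_of_le_left h1 h2
  have s1 := indep_increment_past hX.indep hX.measurable (fun ω => (hX.path ω).zero)
    (fun ω => (hX.path ω).mono) hru
  have s2 := indep_sup_right (hinc.trans hXall) (hpast.trans hXall) hWall s1
    (indep_of_indep_of_le_left hXW' (sup_le hinc hpast))
  have hall : MeasurableSpace.comap (fun ω => X u ω - X r ω) inferInstance ⊔
      ((⨆ s ≤ r, MeasurableSpace.comap (X s) inferInstance) ⊔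
        ⨆ t, MeasurableSpace.comap (W t) inferInstance) ≤ ⨆ t, M.noiseFiltration t := by
    rw [hsup]
    exact sup_le (hinc.trans le_sup_left) (sup_le (hpast.trans le_sup_left) le_sup_right)
  have hvle : M.valueSigma ≤ mΩ := M.measurable_value.comap_le
  have s3 := indep_sup_right (hinc.trans hXall) (sup_le (hpast.trans hXall) hWall) hvle s2
    (indep_of_indep_of_le_left hval hall)
  have s4 := indep_sup_right (m₃ := ⨆ t, 𝓗 t) (hinc.trans hXall)
    (sup_le (sup_le (hpast.trans hXall) hWall) hvle) (iSup_le 𝓗.le) s3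
    (indep_of_indep_of_le_left h𝓗.symm (by
      rw [← sup_assoc, sup_comm M.valueSigma]
      exact sup_le_sup_right hall _))
  refine indep_of_indep_of_le_right s4 ?_
  show M.valueSigma ⊔ M.noiseFiltration r ⊔ 𝓗 r ≤ _
  exact sup_le_sup (sup_le le_sup_right ((hle r).trans le_sup_left)) (le_iSup (fun t => 𝓗 t) r)

theorem noiseFiltration_le (r : I) :
    M.noiseFiltration r ≤ (⨆ s ≤ r, MeasurableSpace.comap (M.ZB s) inferInstance) ⊔
      ⨆ s ≤ r, MeasurableSpace.comap (M.ZS s) inferInstance := by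
  refine iSup₂_le fun s hs => ?_
  refine le_trans (le_of_eq (MeasurableSpace.comap_prodMk (M.ZB s) (M.ZS s))) ?_
  exact sup_le_sup (le_iSup₂_of_le s hs le_rfl) (le_iSup₂_of_le s hs le_rfl)

/-- Additional information that is independent of the market does not change the rate at which
noise buy orders arrive. -/
theorem isCompensated_ZB {𝓗 : Filtration I mΩ}
    (h𝓗 : Indep (⨆ t, 𝓗 t) (M.valueSigma ⊔ ⨆ t, M.noiseFiltration t) M.P) :
    IsCompensated M.P (M.insiderFiltration 𝓗) M.β M.ZB := by
  have := M.isProbabilityMeasure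
  refine M.poisson_ZB.isCompensated_augmentation fun r u hru => ?_
  exact M.indep_increment_insider M.poisson_ZB M.poisson_ZS M.indep_ZB_ZS M.iSup_noiseFiltration
    (fun r => (M.noiseFiltration_le r).trans (sup_le_sup_left (iSup₂_le_iSup _ _) _)) h𝓗 r u hru

theorem isCompensated_ZS {𝓗 : Filtration I mΩ}
    (h𝓗 : Indep (⨆ t, 𝓗 t) (M.valueSigma ⊔ ⨆ t, M.noiseFiltration t) M.P) :
    IsCompensated M.P (M.insiderFiltration 𝓗) M.β M.ZS := by
  have := M.isProbabilityMeasure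
  refine M.poisson_ZS.isCompensated_augmentation fun r u hru => ?_
  exact M.indep_increment_insider M.poisson_ZS M.poisson_ZB M.indep_ZB_ZS.symm
    (M.iSup_noiseFiltration.trans (sup_comm _ _))
    (fun r => ((M.noiseFiltration_le r).trans (sup_comm _ _).le).trans
      (sup_le_sup_left (iSup₂_le_iSup _ _) _)) h𝓗 r u hru

end Market

/-! ### Integrands given by step processes -/

open Classical in
/-- The process `c` restricted to the event `A` and to the times in `(t, u]`. -/
noncomputable def window {Ω : Type*} (t u : I) (A : Set Ω) (c : I → Ω → ℝ) (s : I) (ω : Ω) : ℝ :=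
  if t < s ∧ s ≤ u ∧ ω ∈ A then c s ω else 0

theorem window_of_mem {Ω : Type*} {t u : I} {A : Set Ω} (c : I → Ω → ℝ) {s : I} {ω : Ω}
    (h : t < s ∧ s ≤ u ∧ ω ∈ A) : window t u A c s ω = c s ω := if_pos h

theorem window_of_notMem {Ω : Type*} {t u : I} {A : Set Ω} (c : I → Ω → ℝ) {s : I} {ω : Ω}
    (h : ¬(t < s ∧ s ≤ u ∧ ω ∈ A)) : window t u A c s ω = 0 := if_neg h

open Classical in
/-- A bounded continuous function of an adapted step process and of time, restricted to an event
known at time `t` and to the times in `(t, u]`. It is the process of left limits of a process that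
is restricted to the times in `[t, u)`. -/
theorem IsLeftLimit.of_stepPath {𝓕 : Filtration I mΩ} {K : ℝ} {Y Y' : I → Ω → ℤ}
    (hY : ∀ ω, IsStepPath (fun s => Y s ω) fun s => Y' s ω) (hYm : ∀ s, Measurable[𝓕 s] (Y s))
    {φ : ℤ → I → ℝ} (hφ : ∀ y, Continuous (φ y)) (hK : ∀ y s, |φ y s| ≤ K) (t u : I) {A : Set Ω}
    (hA : MeasurableSet[𝓕 t] A) :
    IsLeftLimit 𝓕 K (fun s ω => if t ≤ s ∧ s < u ∧ ω ∈ A then φ (Y s ω) s else 0)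
      (window t u A fun s ω => φ (Y' s ω) s) where
  measurable s := by
    by_cases hs : t ≤ s ∧ s < u
    · have h1 : MeasurableSet[𝓕 s] {ω | t ≤ s ∧ s < u ∧ ω ∈ A} := by
        simpa only [hs, true_and] using! 𝓕.mono hs.1 _ hA
      exact Measurable.ite h1
        ((Measurable.of_discrete (f := fun y : ℤ => φ y s)).comp (hYm s)) measurable_const
    · have : (fun ω => if t ≤ s ∧ s < u ∧ ω ∈ A then φ (Y s ω) s else 0) = fun _ => 0 := by
        funext ω
        exact if_neg fun h => hs ⟨h.1, h.2.1⟩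
      rw [this]
      exact measurable_const
  bound s ω := by
    split_ifs
    · exact hK _ _
    · rw [abs_zero]
      exact (abs_nonneg _).trans (hK 0 0)
  left ω s := by
    by_cases hA : ω ∈ A
    swap
    · rw [window_of_notMem _ fun h => hA h.2.2]
      simp only [hA, and_false, if_false]
      exact tendsto_const_nhds
    rcases le_or_gt s t with hst | hst
    · rw [window_of_notMem _ fun h => hst.not_gt h.1]
      refine tendsto_const_nhds.congr' ?_
      filter_upwards [self_mem_nhdsWithin] with r hr
      rw [if_neg fun h => (h.1.trans_lt hr).not_ge hst]
    rcases le_or_gt s u with hsu | hsu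
    · rw [window_of_mem _ ⟨hst, hsu, hA⟩]
      have h1 : Tendsto (φ (Y' s ω)) (𝓝[<] s) (𝓝 (φ (Y' s ω) s)) :=
        ((hφ _).tendsto s).mono_left nhdsWithin_le_nhds
      refine h1.congr' ?_
      filter_upwards [self_mem_nhdsWithin, (hY ω).left s, Ioo_mem_nhdsLT hst] with r hr h2 h3
      rw [if_pos ⟨h3.1.le, lt_of_lt_of_le hr hsu, hA⟩, h2]
    · rw [window_of_notMem _ fun h => hsu.not_ge h.2.1]
      refine tendsto_const_nhds.congr' ?_
      filter_upwards [Ioo_mem_nhdsLT hsu] with r hr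
      rw [if_neg fun h => hr.1.not_gt h.2.1]
  zero ω := window_of_notMem _ fun h => not_lt_bot h.1

namespace Market

variable {N : ℕ} (M : Market Ω N)

/-! ### The noise demand -/

/-- The left limit of the cumulative noise demand. -/
noncomputable def Zleft (t : I) (ω : Ω) : ℤ :=
  ((Function.leftLim (fun s => M.ZB s ω) t : ℕ) : ℤ) -
    (Function.leftLim (fun s => M.ZS s ω) t : ℕ)

theorem isStepPath_Z (ω : Ω) : IsStepPath (fun s => M.Z s ω) fun s => M.Zleft s ω :=
  ((M.poisson_ZB.path ω).isStepPath.prodMk (M.poisson_ZS.path ω).isStepPath).map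
    fun x : ℕ × ℕ => (x.1 : ℤ) - x.2

theorem measurable_Z (t : I) : Measurable (M.Z t) :=
  (Measurable.of_discrete (f := fun x : ℕ × ℕ => (x.1 : ℤ) - x.2)).comp (M.measurable_noise t)

theorem Z_zero (ω : Ω) : M.Z 0 ω = 0 := by
  simp [Z, (M.poisson_ZB.path ω).zero, (M.poisson_ZS.path ω).zero]

theorem measurable_insider_noise (𝓗 : Filtration I mΩ) (t : I) :
    Measurable[M.insiderFiltration 𝓗 t] fun ω => (M.ZB t ω, M.ZS t ω) := by
  have h1 : M.noiseFiltration t ≤ M.insiderFiltration 𝓗 t := by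
    refine le_trans ?_ (Filtration.le_rightCont _ t)
    exact (le_sup_right.trans le_sup_left : M.noiseFiltration t ≤ M.valueSigma ⊔
      M.noiseFiltration t ⊔ 𝓗 t).trans le_sup_left
  refine Measurable.mono ?_ h1 le_rfl
  rw [measurable_iff_comap_le]
  exact le_iSup₂_of_le (f := fun s (_ : s ≤ t) => MeasurableSpace.comap
      (fun ω => (M.ZB s ω, M.ZS s ω)) inferInstance) t le_rfl le_rfl

theorem measurable_insider_Z (𝓗 : Filtration I mΩ) (t : I) :
    Measurable[M.insiderFiltration 𝓗 t] (M.Z t) :=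
  (Measurable.of_discrete (f := fun x : ℕ × ℕ => (x.1 : ℤ) - x.2)).comp
    (M.measurable_insider_noise 𝓗 t)

/-- The expectation of `f (y + Z_t)`. -/
noncomputable def noiseMean (f : ℤ → ℝ) (y : ℤ) (t : I) : ℝ := ∫ ω, f (y + M.Z t ω) ∂M.P

variable {f : ℤ → ℝ} {B : ℝ}

theorem measurable_comp_Z (f : ℤ → ℝ) (y : ℤ) (t : I) : Measurable fun ω => f (y + M.Z t ω) :=
  (Measurable.of_discrete (f := fun z : ℤ => f (y + z))).comp (M.measurable_Z t)

theorem integrable_comp_Z (hf : ∀ y, |f y| ≤ B) (y : ℤ) (t : I) :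
    Integrable (fun ω => f (y + M.Z t ω)) M.P := by
  have := M.isProbabilityMeasure
  exact (integrable_const B).mono' (M.measurable_comp_Z f y t).aestronglyMeasurable
    (.of_forall fun ω => hf _)

theorem noiseMean_mono (hf : Monotone f) (hB : ∀ y, |f y| ≤ B) (t : I) :
    Monotone fun y => M.noiseMean f y t := fun _ _ hyz =>
  integral_mono (M.integrable_comp_Z hB _ t) (M.integrable_comp_Z hB _ t)
    fun _ => hf (Int.add_le_add_right hyz _)

theorem abs_noiseMean_le (hf : ∀ y, |f y| ≤ B) (y : ℤ) (t : I) : |M.noiseMean f y t| ≤ B := by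
  have := M.isProbabilityMeasure
  have h := norm_integral_le_of_norm_le_const (μ := M.P) (f := fun ω => f (y + M.Z t ω)) (C := B)
    (.of_forall fun ω => hf _)
  simpa [noiseMean] using h

/-- The value of `f (y + Z)` changes only with a noise order, and these arrive at the total rate
`2 * β`. -/
theorem noiseMean_sub_le (hf : ∀ y, |f y| ≤ B) (y : ℤ) {s t : I} (hst : s ≤ t) :
    |M.noiseMean f y t - M.noiseMean f y s| ≤ 4 * B * M.β * ((t : ℝ) - s) := by
  have := M.isProbabilityMeasure
  have hB : 0 ≤ B := (abs_nonneg _).trans (hf 0)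
  rw [noiseMean, noiseMean, ← integral_sub (M.integrable_comp_Z hf y t)
    (M.integrable_comp_Z hf y s)]
  have i1 := M.poisson_ZB.integrable_sub hst
  have i2 := M.poisson_ZS.integrable_sub hst
  calc |∫ ω, (f (y + M.Z t ω) - f (y + M.Z s ω)) ∂M.P|
      ≤ ∫ ω, |f (y + M.Z t ω) - f (y + M.Z s ω)| ∂M.P := abs_integral_le_integral_abs
    _ ≤ ∫ ω, 2 * B * (((M.ZB t ω : ℝ) - M.ZB s ω) + ((M.ZS t ω : ℝ) - M.ZS s ω)) ∂M.P := by
        refine integral_mono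
          ((M.integrable_comp_Z hf y t).sub (M.integrable_comp_Z hf y s)).abs
          ((i1.add i2).const_mul _) fun ω => ?_
        show |f (y + M.Z t ω) - f (y + M.Z s ω)|
          ≤ 2 * B * (((M.ZB t ω : ℝ) - M.ZB s ω) + ((M.ZS t ω : ℝ) - M.ZS s ω))
        have hb : M.ZB s ω ≤ M.ZB t ω := (M.poisson_ZB.path ω).mono hst
        have hs : M.ZS s ω ≤ M.ZS t ω := (M.poisson_ZS.path ω).mono hst
        by_cases h : M.ZB s ω = M.ZB t ω ∧ M.ZS s ω = M.ZS t ω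
        · simp [Z, h.1, h.2]
        · have h1 : 1 ≤ ((M.ZB t ω : ℝ) - M.ZB s ω) + ((M.ZS t ω : ℝ) - M.ZS s ω) := by
            have : M.ZB s ω + M.ZS s ω + 1 ≤ M.ZB t ω + M.ZS t ω := by omega
            have : (M.ZB s ω : ℝ) + M.ZS s ω + 1 ≤ M.ZB t ω + M.ZS t ω := by exact_mod_cast this
            linarith
          calc |f (y + M.Z t ω) - f (y + M.Z s ω)| ≤ B + B :=
                (abs_sub _ _).trans (add_le_add (hf _) (hf _))
            _ = 2 * B * 1 := by ring
            _ ≤ _ := mul_le_mul_of_nonneg_left h1 (by positivity)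
    _ = 4 * B * M.β * ((t : ℝ) - s) := by
        rw [integral_const_mul, integral_add i1 i2, M.poisson_ZB.integral_sub hst,
          M.poisson_ZS.integral_sub hst]
        ring

theorem continuous_noiseMean (hf : ∀ y, |f y| ≤ B) (y : ℤ) : Continuous (M.noiseMean f y) := by
  have hB : 0 ≤ B := (abs_nonneg _).trans (hf 0)
  refine (LipschitzWith.of_dist_le_mul (K := (4 * B * M.β).toNNReal) fun t s => ?_).continuous
  rw [Real.coe_toNNReal _ (by positivity), Real.dist_eq, Subtype.dist_eq, Real.dist_eq]
  rcases le_total s t with h | h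
  · rw [abs_of_nonneg (sub_nonneg.2 (Subtype.coe_le_coe.2 h))]
    exact M.noiseMean_sub_le hf y h
  · rw [abs_sub_comm, abs_sub_comm (t : ℝ), abs_of_nonneg (sub_nonneg.2 (Subtype.coe_le_coe.2 h))]
    exact M.noiseMean_sub_le hf y h

/-- There is almost surely no noise order at a fixed time. -/
theorem integral_Zleft (hf : ∀ y, |f y| ≤ B) (y : ℤ) {s : I} (hs : 0 < s) :
    Integrable (fun ω => f (y + M.Zleft s ω)) M.P ∧
      ∫ ω, f (y + M.Zleft s ω) ∂M.P = M.noiseMean f y s := by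
  have := M.isProbabilityMeasure
  have hlim : ∀ ω, Tendsto (fun n => f (y + M.Z (grid n (gridIdx n s)) ω)) atTop
      (𝓝 (f (y + M.Zleft s ω))) := by
    intro ω
    refine tendsto_const_nhds.congr' ?_
    filter_upwards [(tendsto_grid_gridIdx hs).eventually ((M.isStepPath_Z ω).left s)] with n hn
    rw [hn]
  have hm : Measurable fun ω => f (y + M.Zleft s ω) :=
    measurable_of_tendsto_metrizable (fun n => M.measurable_comp_Z f y _) (tendsto_pi_nhds.2 hlim)
  refine ⟨(integrable_const B).mono' hm.aestronglyMeasurable (.of_forall fun ω => hf _), ?_⟩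
  refine tendsto_nhds_unique (f := fun n => M.noiseMean f y (grid n (gridIdx n s))) (l := atTop) ?_
    (((M.continuous_noiseMean hf y).tendsto s).comp
      ((tendsto_grid_gridIdx hs).mono_right nhdsWithin_le_nhds))
  exact tendsto_integral_of_dominated_convergence (fun _ => B)
    (fun n => (M.measurable_comp_Z f y _).aestronglyMeasurable) (integrable_const B)
    (fun n => .of_forall fun ω => hf _) (.of_forall hlim)

theorem indep_bot_filtration :
    Indep (⨆ t, (⊥ : Filtration I mΩ) t) (M.valueSigma ⊔ ⨆ t, M.noiseFiltration t) M.P := by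
  have := M.isProbabilityMeasure
  have : (⨆ t, (⊥ : Filtration I mΩ) t) = ⊥ := iSup_eq_bot.2 fun t => rfl
  rw [this]
  exact indep_bot_left _

/-- The Kolmogorov equation of the noise demand in integrated form: the telescoping sum of the
jumps of `f (y + Z)` is compensated at the rate `β` of the noise orders. -/
theorem noiseMean_sub_eq (hf : ∀ y, |f y| ≤ B) (y : ℤ) (u : I) :
    M.noiseMean f y u - f y = M.β * ∫ s in Ioc 0 u,
      (M.noiseMean f (y + 1) s - 2 * M.noiseMean f y s + M.noiseMean f (y - 1) s) := by
  classical
  have := M.isProbabilityMeasure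
  set 𝓕 := M.insiderFiltration ⊥
  have hb : ∀ (y z : ℤ) (_ : I), |f y - f z| ≤ B + B := fun y z _ =>
    (abs_sub _ _).trans (add_le_add (hf _) (hf _))
  have hup := IsLeftLimit.of_stepPath (𝓕 := 𝓕) M.isStepPath_Z (M.measurable_insider_Z ⊥)
    (φ := fun z _ => f (y + 1 + z) - f (y + z)) (fun _ => continuous_const)
    (fun z s => hb _ _ s) 0 u MeasurableSet.univ
  have hdn := IsLeftLimit.of_stepPath (𝓕 := 𝓕) M.isStepPath_Z (M.measurable_insider_Z ⊥)
    (φ := fun z _ => f (y - 1 + z) - f (y + z)) (fun _ => continuous_const)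
    (fun z s => hb _ _ s) 0 u MeasurableSet.univ
  have cB := M.isCompensated_ZB M.indep_bot_filtration
  have cS := M.isCompensated_ZS M.indep_bot_filtration
  have eB := cB.integral_tsum_eq hup
  have eS := cS.integral_tsum_eq hdn
  -- the path identity
  have hpath : ∀ᵐ ω ∂M.P, f (y + M.Z u ω) - f y
      = ∑' s : I, window 0 u univ (fun s ω => f (y + 1 + M.Zleft s ω) - f (y + M.Zleft s ω)) s ω
          * (jump (fun t => M.ZB t ω) s : ℝ)
        + ∑' s : I, window 0 u univ (fun s ω => f (y - 1 + M.Zleft s ω) - f (y + M.Zleft s ω)) s ω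
          * (jump (fun t => M.ZS t ω) s : ℝ) := by
    filter_upwards [ae_no_common_jump M.poisson_ZB M.poisson_ZS M.indep_ZB_ZS] with ω hω
    have pB := M.poisson_ZB.path ω
    have pS := M.poisson_ZS.path ω
    set J := pB.finite_support_jump.toFinset ∪ pS.finite_support_jump.toFinset with hJ
    have hJB : ∀ t, jump (fun t => M.ZB t ω) t ≠ 0 → t ∈ J := fun t ht => by simp [hJ, ht]
    have hJS : ∀ t, jump (fun t => M.ZS t ω) t ≠ 0 → t ∈ J := fun t ht => by simp [hJ, ht]
    have tel := ((M.isStepPath_Z ω).map fun z => f (y + z)).sub_eq_sum J (fun t ht => by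
      by_contra hn
      have h1 := (pB.jump_eq_zero_iff t).1 (not_imp_comm.1 (hJB t) hn)
      have h2 := (pS.jump_eq_zero_iff t).1 (not_imp_comm.1 (hJS t) hn)
      exact ht (by simp [Zleft, Z, h1, h2])) (t := 0) (u := u) bot_le
    simp only [M.Z_zero, add_zero] at tel
    rw [tel, tsum_eq_sum (s := J) (fun t ht => by
      rw [not_imp_comm.1 (hJB t) ht, Nat.cast_zero, mul_zero]), tsum_eq_sum (s := J) (fun t ht => by
      rw [not_imp_comm.1 (hJS t) ht, Nat.cast_zero, mul_zero]), ← Finset.sum_add_distrib,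
      Finset.sum_filter]
    refine Finset.sum_congr rfl fun s _ => ?_
    by_cases hs : 0 < s ∧ s ≤ u
    · rw [if_pos hs, window_of_mem _ ⟨hs.1, hs.2, mem_univ ω⟩,
        window_of_mem _ ⟨hs.1, hs.2, mem_univ ω⟩]
      have hZ : M.Z s ω = M.Zleft s ω + (jump (fun t => M.ZB t ω) s : ℤ)
          - (jump (fun t => M.ZS t ω) s : ℤ) := by
        have h1 : Function.leftLim (fun s => M.ZB s ω) s + jump (fun s => M.ZB s ω) s = M.ZB s ω :=
          pB.leftLim_add_jump s
        have h2 : Function.leftLim (fun s => M.ZS s ω) s + jump (fun s => M.ZS s ω) s = M.ZS s ω :=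
          pS.leftLim_add_jump s
        rw [Z, Zleft, ← h1, ← h2]
        push_cast
        ring
      rw [hZ]
      have l1 := pB.jump_le_one s
      have l2 := pS.jump_le_one s
      have hc := hω s
      generalize jump (fun t => M.ZB t ω) s = b at *
      generalize jump (fun t => M.ZS t ω) s = c at *
      generalize M.Zleft s ω = z
      interval_cases b <;> interval_cases c
      · simp
      · simp [show y + (z - 1) = y - 1 + z by ring]
      · simp [show y + (z + 1) = y + 1 + z by ring]
      · simp at hc
    · rw [if_neg hs, window_of_notMem _ fun h => hs ⟨h.1, h.2.1⟩,
        window_of_notMem _ fun h => hs ⟨h.1, h.2.1⟩]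
      ring
  have partB := IsJumpPart.refl M.ZB
  have partS := IsJumpPart.refl M.ZS
  have lhs : M.noiseMean f y u - f y = ∫ ω, (f (y + M.Z u ω) - f y) ∂M.P := by
    rw [integral_sub (M.integrable_comp_Z hf y u) (integrable_const _), integral_const,
      probReal_univ, one_smul, noiseMean]
  rw [lhs, integral_congr_ae hpath, integral_add (cB.integrable_tsum partB hup)
    (cS.integrable_tsum partS hdn), eB, eS, ← mul_add]
  have bint : ∀ {ξ ξ' : I → Ω → ℝ}, IsLeftLimit 𝓕 (B + B) ξ ξ' →
      Integrable (fun z : Ω × I => ξ' z.2 z.1) (M.P.prod volume) := fun h =>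
    (integrable_const (B + B)).mono' h.measurable_uncurry.aestronglyMeasurable
      (.of_forall fun z => h.bound' _ _)
  have hadd : Integrable (fun z : Ω × I =>
      window 0 u univ (fun s ω => f (y + 1 + M.Zleft s ω) - f (y + M.Zleft s ω)) z.2 z.1 +
        window 0 u univ (fun s ω => f (y - 1 + M.Zleft s ω) - f (y + M.Zleft s ω)) z.2 z.1)
      (M.P.prod volume) := (bint hup).add (bint hdn)
  rw [← integral_add (bint hup) (bint hdn), integral_prod_symm _ hadd,
    ← integral_indicator measurableSet_Ioc]
  congr 2
  funext s
  by_cases hs : 0 < s ∧ s ≤ u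
  · rw [indicator_of_mem (show s ∈ Ioc 0 u from hs)]
    simp only [window_of_mem _ (show 0 < s ∧ s ≤ u ∧ _ ∈ univ from ⟨hs.1, hs.2, mem_univ _⟩)]
    have h0 := M.integral_Zleft hf y hs.1
    have h1 := M.integral_Zleft hf (y + 1) hs.1
    have h2 := M.integral_Zleft hf (y - 1) hs.1
    have i1 : Integrable (fun ω => f (y + 1 + M.Zleft s ω) - f (y + M.Zleft s ω)) M.P :=
      h1.1.sub h0.1
    have i2 : Integrable (fun ω => f (y - 1 + M.Zleft s ω) - f (y + M.Zleft s ω)) M.P :=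
      h2.1.sub h0.1
    rw [integral_add i1 i2, integral_sub h1.1 h0.1,
      integral_sub h2.1 h0.1, h0.2, h1.2, h2.2]
    ring
  · rw [indicator_of_notMem (show s ∉ Ioc 0 u from hs)]
    have : ∀ ω : Ω, ¬ (0 < s ∧ s ≤ u ∧ ω ∈ univ) := fun ω h => hs ⟨h.1, h.2.1⟩
    simp only [window_of_notMem _ (this _), add_zero, integral_zero]

/-! ### The pricing rule -/

variable {a : Fin (N + 1) → EReal}

/-- A bound on the possible values of the asset. -/
noncomputable def valueBound : ℝ := ∑ n, |M.v n|

theorem abs_terminalPrice_le (a : Fin (N + 1) → EReal) (y : ℤ) :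
    |M.terminalPrice a y| ≤ M.valueBound := by
  refine (Finset.abs_sum_le_sum_abs _ _).trans (Finset.sum_le_sum fun n _ => ?_)
  split_ifs
  · exact le_rfl
  · simp

theorem abs_v_le (n : Fin N) : |M.v n| ≤ M.valueBound :=
  Finset.single_le_sum (f := fun n => |M.v n|) (fun _ _ => abs_nonneg _) (Finset.mem_univ n)

theorem p_eq_noiseMean (a : Fin (N + 1) → EReal) (y : ℤ) (t : I) :
    M.p a y t = M.noiseMean (M.terminalPrice a) y (unitInterval.symm t) := by
  classical
  have := M.isProbabilityMeasure
  have hm : ∀ n, MeasurableSet {ω | InInterval a n (y + M.Z (unitInterval.symm t) ω)} := fun n =>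
    (M.measurable_Z _) (MeasurableSet.of_discrete (s := {z : ℤ | InInterval a n (y + z)}))
  have e : ∀ ω, M.terminalPrice a (y + M.Z (unitInterval.symm t) ω) = ∑ n,
      {ω | InInterval a n (y + M.Z (unitInterval.symm t) ω)}.indicator (fun _ => M.v n) ω := by
    intro ω
    simp [terminalPrice, indicator]
  rw [noiseMean]
  simp_rw [e]
  rw [integral_finsetSum _ fun n _ => (integrable_const _).indicator (hm n)]
  refine Finset.sum_congr rfl fun n _ => ?_
  rw [integral_indicator_const _ (hm n), smul_eq_mul, mul_comm]
  rfl

theorem continuous_p (a : Fin (N + 1) → EReal) (y : ℤ) : Continuous (M.p a y) := by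
  have : M.p a y = fun t => M.noiseMean (M.terminalPrice a) y (unitInterval.symm t) :=
    funext fun t => M.p_eq_noiseMean a y t
  rw [this]
  exact (M.continuous_noiseMean (M.abs_terminalPrice_le a) y).comp unitInterval.continuous_symm

theorem abs_p_le (a : Fin (N + 1) → EReal) (y : ℤ) (t : I) : |M.p a y t| ≤ M.valueBound := by
  rw [p_eq_noiseMean]
  exact M.abs_noiseMean_le (M.abs_terminalPrice_le a) y _

/-- The backward equation of the pricing rule, integrated over `(t, 1]`. -/
theorem p_sub_terminalPrice (a : Fin (N + 1) → EReal) (y : ℤ) (t : I) :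
    M.p a y t - M.terminalPrice a y
      = M.β * ∫ r in Ioc t 1, (M.p a (y + 1) r - 2 * M.p a y r + M.p a (y - 1) r) := by
  rw [p_eq_noiseMean, M.noiseMean_sub_eq (M.abs_terminalPrice_le a)]
  congr 1
  rw [← unitInterval.measurePreserving_symm.setIntegral_preimage_emb
    unitInterval.symmMeasurableEquiv.measurableEmbedding]
  have : unitInterval.symm ⁻¹' Ioc 0 (unitInterval.symm t) = Ico t 1 := by
    ext r
    simp only [mem_preimage, mem_Ioc, mem_Ico, unitInterval.symm_le_symm]
    rw [and_comm, unitInterval.pos_iff_ne_zero, unitInterval.lt_one_iff_ne_one, Ne,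
      unitInterval.symm_eq_zero]
  rw [this, setIntegral_congr_set Ico_ae_eq_Ioc]
  simp_rw [p_eq_noiseMean]

theorem IsLevelSequence.inInterval_mono (ha : M.IsLevelSequence a) {n m : Fin N} {y z : ℤ}
    (hy : InInterval a n y) (hz : InInterval a m z) (hyz : y ≤ z) : n ≤ m := by
  by_contra h
  have h1 : m.succ ≤ n.castSucc := by
    rw [Fin.le_def, Fin.val_succ, Fin.val_castSucc]
    exact Fin.lt_def.1 (not_le.1 h)
  have h2 : ((y : ℝ) : EReal) ≤ ((z : ℝ) : EReal) := by exact_mod_cast hyz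
  exact absurd ((ha.strictMono.monotone h1).trans (hy.1.trans h2)) (not_le.2 hz.2)

theorem IsLevelSequence.terminalPrice_eq (ha : M.IsLevelSequence a) {n : Fin N} {y : ℤ}
    (hy : InInterval a n y) : M.terminalPrice a y = M.v n := by
  rw [terminalPrice, Finset.sum_eq_single n, if_pos hy]
  · intro m _ hm
    exact if_neg fun h => hm (le_antisymm (ha.inInterval_mono M h hy le_rfl)
      (ha.inInterval_mono M hy h le_rfl))
  · simp

theorem IsLevelSequence.monotone_terminalPrice (ha : M.IsLevelSequence a) :
    Monotone (M.terminalPrice a) := by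
  intro y z hyz
  obtain ⟨n, hn⟩ := ha.cover y
  obtain ⟨m, hm⟩ := ha.cover z
  rw [ha.terminalPrice_eq M hn, ha.terminalPrice_eq M hm]
  exact M.v_strictMono.monotone (ha.inInterval_mono M hn hm hyz)

theorem IsLevelSequence.monotone_p (ha : M.IsLevelSequence a) (t : I) :
    Monotone fun y => M.p a y t := by
  simp_rw [p_eq_noiseMean]
  exact M.noiseMean_mono (ha.monotone_terminalPrice M) (M.abs_terminalPrice_le a) _

end Market

/-! ### The profit along a path -/

/-- The profit of the orders at one point in time, as a function of the jumps `b`, `c` of the noise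
buy and sell orders and of the jumps `x`, `z` of the insider's buy and sell orders, when the value
is `v` and the demand before these orders is `y`. -/
def jumpProfit (q : ℤ → ℝ) (v : ℝ) (y : ℤ) (b c x z : ℕ) : ℝ :=
  (v - q (y + 1)) * ((x * ((1 - b) * (1 - c)) : ℕ) : ℝ)
    + (v - q (y + 2)) * ((x * b : ℕ) : ℝ) + (v - q y) * ((x * c : ℕ) : ℝ)
    - (v - q (y - 1)) * ((z * ((1 - b) * (1 - c)) : ℕ) : ℝ)
    - (v - q (y - 2)) * ((z * c : ℕ) : ℝ) - (v - q y) * ((z * b : ℕ) : ℝ)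

/-- A function whose increments are `q - v` loses at least the profit of the insider's orders, up to
what the noise orders alone contribute. A sell order attains equality; for a buy order the price is
the one after the order, while the decrease of the function is given by the lower price before it. -/
theorem jumpProfit_le {q g : ℤ → ℝ} {v : ℝ} (hq : Monotone q)
    (hg : ∀ y, g (y + 1) - g y = q y - v) (y : ℤ) {b c x z : ℕ} (hb : b ≤ 1) (hc : c ≤ 1)
    (hx : x ≤ 1) (hz : z ≤ 1) (hbc : b = 0 ∨ c = 0) :
    jumpProfit q v y b c x z ≤ g y - g (y + b - c + x - z)
      + ((q y - v) * b + (v - q (y - 1)) * c) := by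
  have h1 : g (y - 1) - g (y - 2) = q (y - 2) - v := by
    have := hg (y - 2); rwa [show y - 2 + 1 = y - 1 by ring] at this
  have h2 : g y - g (y - 1) = q (y - 1) - v := by
    have := hg (y - 1); rwa [show y - 1 + 1 = y by ring] at this
  have h3 := hg y
  have h4 : g (y + 2) - g (y + 1) = q (y + 1) - v := by
    have := hg (y + 1); rwa [show y + 1 + 1 = y + 2 by ring] at this
  have m1 : q (y - 2) ≤ q (y - 1) := hq (by omega)
  have m2 : q (y - 1) ≤ q y := hq (by omega)
  have m3 : q y ≤ q (y + 1) := hq (by omega)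
  have m4 : q (y + 1) ≤ q (y + 2) := hq (by omega)
  have e : y + 2 - 1 = y + 1 := by ring
  unfold jumpProfit
  interval_cases b <;> interval_cases c <;> interval_cases x <;> interval_cases z <;>
    first
    | (exfalso; omega)
    | (simp only [Nat.cast_zero, Nat.cast_one, Nat.sub_self, Nat.sub_zero, add_zero, sub_zero,
        mul_zero, mul_one, add_sub_cancel_right, sub_add_cancel, sub_sub, add_assoc,
        Int.reduceAdd, zero_add, sub_self, e]
       linarith)

/-- The orders are those of the counting paths `b`, `c` (noise) and `x`, `z` (insider); `Y` is the
resulting demand, `Y'` its path of left limits, and `J` contains all times of orders. The function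
`g y s = T y + β ∫_s^1 (p y - p (y - 1))` has increments `p - v` in `y` and `T ≥ 0`. Then the profit
after time `t` is at most `g (Y t) t` plus a term that the intensity `β` of the noise orders
compensates. -/
theorem sum_jumpProfit_le {p : ℤ → I → ℝ} {T : ℤ → ℝ} {v β : ℝ} (hp : ∀ y, Continuous (p y))
    (hmono : ∀ s, Monotone fun y => p y s) (hT : ∀ y, 0 ≤ T y) {g : ℤ → I → ℝ}
    (hgdef : ∀ y s, g y s = T y + β * ∫ r in Ioc s 1, (p y r - p (y - 1) r))
    (hg : ∀ y s, g (y + 1) s - g y s = p y s - v) {b c x z : I → ℕ} (hb : IsCountingPath b)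
    (hc : IsCountingPath c) (hx : IsCountingPath x) (hz : IsCountingPath z)
    (hbc : ∀ s, jump b s = 0 ∨ jump c s = 0) {Y Y' : I → ℤ} (hY : IsStepPath Y Y')
    (hYj : ∀ s, Y s = Y' s + jump b s - jump c s + jump x s - jump z s) (J : Finset I)
    (hJ : ∀ s, Y' s ≠ Y s → s ∈ J) (t : I) :
    ∑ s ∈ J with t < s,
        jumpProfit (fun y => p y s) v (Y' s) (jump b s) (jump c s) (jump x s) (jump z s)
      ≤ g (Y t) t - β * (∫ r in Ioc t 1, (p (Y' r) r - p (Y' r - 1) r))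
        + ∑ s ∈ J with t < s,
          ((p (Y' s) s - v) * jump b s + (v - p (Y' s - 1) s) * jump c s) := by
  set κ : ℤ → I → ℝ := fun y r => p y r - p (y - 1) r with hκ
  have hκc : ∀ y, Continuous (κ y) := fun y => (hp y).sub (hp _)
  have hκi : ∀ y, Integrable (κ y) := fun y =>
    (hκc y).integrable_of_hasCompactSupport (HasCompactSupport.of_compactSpace _)
  -- Each order separately.
  have step1 : ∑ s ∈ J with t < s,
        jumpProfit (fun y => p y s) v (Y' s) (jump b s) (jump c s) (jump x s) (jump z s)
      ≤ ∑ s ∈ J with t < s, (g (Y' s) s - g (Y s) s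
        + ((p (Y' s) s - v) * jump b s + (v - p (Y' s - 1) s) * jump c s)) := by
    refine Finset.sum_le_sum fun s _ => ?_
    rw [hYj s]
    exact jumpProfit_le (q := fun y => p y s) (g := fun y => g y s) (hmono s) (fun y => hg y s) _
      (hb.jump_le_one s) (hc.jump_le_one s) (hx.jump_le_one s) (hz.jump_le_one s) (hbc s)
  -- For every fixed function of the demand, its changes telescope.
  have tel : ∀ (F : ℤ → ℝ) (u : I), t ≤ u →
      F (Y u) - F (Y t) = ∑ s ∈ J with t < s ∧ s ≤ u, (F (Y s) - F (Y' s)) := fun F u htu =>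
    (hY.map F).sub_eq_sum J (fun s hs => hJ s fun h => hs (congrArg F h)) htu
  have hfil : ∀ F : I → ℝ, ∑ s ∈ J with t < s, F s = ∑ s ∈ J with t < s ∧ s ≤ 1, F s := fun F =>
    Finset.sum_congr (Finset.filter_congr fun s _ =>
      ⟨fun h => ⟨h, le_top⟩, fun h => h.1⟩) fun _ _ => rfl
  have hind : ∀ (s : I) (F : I → ℝ), t < s →
      ∫ r in Ioc s 1, F r = ∫ r in Ioc t 1, (Icc s 1).indicator F r := by
    intro s F hts
    have hsub : Icc s 1 ⊆ Ioc t 1 := fun r hr => ⟨hts.trans_le hr.1, hr.2⟩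
    rw [setIntegral_indicator measurableSet_Icc, ← integral_Icc_eq_integral_Ioc,
      inter_eq_right.2 hsub]
  -- A change of the demand at time `s` affects the integrand at all times `r ≥ s`.
  have step2 : ∑ s ∈ J with t < s, ((∫ r in Ioc s 1, κ (Y s) r) - ∫ r in Ioc s 1, κ (Y' s) r)
      = (∫ r in Ioc t 1, κ (Y r) r) - ∫ r in Ioc t 1, κ (Y t) r := by
    have e1 : ∀ s ∈ J.filter (t < ·), ((∫ r in Ioc s 1, κ (Y s) r) - ∫ r in Ioc s 1, κ (Y' s) r)
        = ∫ r in Ioc t 1, (Icc s 1).indicator (fun r => κ (Y s) r - κ (Y' s) r) r := by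
      intro s hs
      rw [← integral_sub (hκi _).integrableOn (hκi _).integrableOn]
      exact hind s _ (Finset.mem_filter.1 hs).2
    have i1 : ∀ s ∈ J.filter (t < ·), Integrable
        ((Icc s 1).indicator (fun r => κ (Y s) r - κ (Y' s) r)) (volume.restrict (Ioc t 1)) :=
      fun s _ => (((hκi _).sub (hκi _)).indicator measurableSet_Icc).integrableOn
    rw [Finset.sum_congr rfl e1, ← integral_finsetSum _ i1]
    have e2 : ∫ r in Ioc t 1, κ (Y r) r = ∫ r in Ioc t 1, (κ (Y t) r +
        ∑ s ∈ J with t < s, (Icc s 1).indicator (fun r => κ (Y s) r - κ (Y' s) r) r) := by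
      refine setIntegral_congr_fun measurableSet_Ioc fun r hr => ?_
      have := tel (fun y => κ y r) r hr.1.le
      rw [← Finset.filter_filter, Finset.sum_filter] at this
      show κ (Y r) r = _
      rw [← sub_eq_iff_eq_add', this]
      refine Finset.sum_congr rfl fun s _ => ?_
      by_cases hsr : s ≤ r
      · rw [if_pos hsr, indicator_of_mem (mem_Icc.2 ⟨hsr, hr.2⟩)]
      · rw [if_neg hsr, indicator_of_notMem fun h => hsr h.1]
    rw [e2, integral_add (hκi _).integrableOn (integrable_finsetSum _ i1), add_sub_cancel_left]
  have step3 : ∑ s ∈ J with t < s, (g (Y' s) s - g (Y s) s)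
      = g (Y t) t - T (Y 1) - β * ∫ r in Ioc t 1, κ (Y r) r := by
    have e : ∀ s, g (Y' s) s - g (Y s) s = -(T (Y s) - T (Y' s))
        - β * ((∫ r in Ioc s 1, κ (Y s) r) - ∫ r in Ioc s 1, κ (Y' s) r) := by
      intro s
      rw [hgdef, hgdef]
      ring
    simp_rw [e]
    rw [Finset.sum_sub_distrib, Finset.sum_neg_distrib, ← Finset.mul_sum, step2,
      hfil fun s => T (Y s) - T (Y' s), ← tel T 1 le_top, hgdef (Y t) t]
    ring
  -- `Y` and its left limits differ at finitely many times only.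
  have step4 : ∫ r in Ioc t 1, κ (Y r) r = ∫ r in Ioc t 1, κ (Y' r) r := by
    refine setIntegral_congr_ae measurableSet_Ioc ?_
    have h0 : volume {r | Y' r ≠ Y r} = 0 := hY.finite_jumps.measure_zero _
    filter_upwards [compl_mem_ae_iff.2 h0] with r hr _
    rw [not_not.1 hr]
  rw [Finset.sum_add_distrib, step3, step4] at step1
  have := hT (Y 1)
  linarith

namespace Market

variable {N : ℕ} (M : Market Ω N) {a : Fin (N + 1) → EReal}

/-! ### The bounding function -/

/-- The terminal value of `US`. -/
noncomputable def terminalUS (a : Fin (N + 1) → EReal) (n : Fin N) (y : ℤ) : ℝ :=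
  open Classical in if Above a n y then M.terminalU a n y else M.terminalU a n (y - 1)

theorem Above.mono {n : Fin N} {y z : ℤ} (h : Above a n y) (hyz : y ≤ z) : Above a n z :=
  lt_of_lt_of_le h (by exact_mod_cast hyz)

/-- The two branches in the definition of `US` are given by the same formula. -/
theorem US_eq (a : Fin (N + 1) → EReal) (n : Fin N) (y : ℤ) (t : I) :
    M.US a n y t = M.terminalUS a n y + M.β * ∫ r in Ioc t 1, (M.p a y r - M.p a (y - 1) r) := by
  by_cases h : Above a n y
  · rw [US, if_pos h, terminalUS, if_pos h, U, if_pos h]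
  · rw [US, if_neg h, terminalUS, if_neg h, U, if_neg fun h' => h (Above.mono h' (by omega)),
      sub_add_cancel]

/-- The three possible shapes of an interval, with the position of its middle level. -/
theorem IsLevelSequence.interval_cases (ha : M.IsLevelSequence a) (n : Fin N) :
    (a n.castSucc = ⊥ ∧ a n.succ ≠ ⊥ ∧ ∀ y, Above a n y) ∨
    (∃ k : ℤ, a n.castSucc = ((k : ℝ) : EReal) ∧ a n.succ = ⊤ ∧ ∀ y, ¬ Above a n y) ∨
    ∃ k l : ℤ, a n.castSucc = ((k : ℝ) : EReal) ∧ a n.succ = ((l : ℝ) : EReal) ∧ k < l ∧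
      (∀ y, Above a n y ↔ k + l - 1 < 2 * y) ∧ ∀ y, k + l - 1 ≠ 2 * y := by
  have hlt : a n.castSucc < a n.succ := ha.strictMono n.castSucc_lt_succ
  rcases ha.mem n.castSucc with h1 | h1 | ⟨k, h1⟩
  · refine Or.inl ⟨h1, (bot_le.trans_lt hlt).ne', fun y => ?_⟩
    rw [Above, middle, h1, EReal.bot_add, EReal.bot_sub,
      EReal.bot_div_of_pos_ne_top (by norm_num) (by exact EReal.coe_ne_top 2)]
    exact EReal.bot_lt_coe _
  · rw [h1] at hlt
    exact absurd hlt not_top_lt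
  · rcases ha.mem n.succ with h2 | h2 | ⟨l, h2⟩
    · rw [h2] at hlt
      exact absurd hlt not_lt_bot
    · refine Or.inr (Or.inl ⟨k, h1, h2, fun y => ?_⟩)
      have h3 : middle a n = ⊤ := by
        rw [middle, h1, h2, EReal.coe_add_top]
        rw [show (⊤ : EReal) - 1 = ⊤ from EReal.top_sub_coe 1]
        exact EReal.top_div_of_pos_ne_top (by norm_num) (EReal.coe_ne_top 2)
      rw [Above, h3]
      exact not_top_lt
    · have h3 : middle a n = ((((k : ℝ) + l - 1) / 2 : ℝ) : EReal) := by
        rw [middle, h1, h2]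
        rfl
      refine Or.inr (Or.inr ⟨k, l, h1, h2, ?_, fun y => ?_, fun y hy => ?_⟩)
      · rw [h1, h2] at hlt
        exact_mod_cast hlt
      · rw [Above, h3, EReal.coe_lt_coe_iff, div_lt_iff₀ (by norm_num), mul_comm]
        exact_mod_cast Iff.rfl
      · refine ha.middle_ne n y ?_
        rw [h3]
        congr 1
        have : (k : ℝ) + l - 1 = 2 * y := by exact_mod_cast hy
        rw [this]
        ring

theorem IsLevelSequence.finite_above (ha : M.IsLevelSequence a) (n : Fin N) (y : ℤ) :
    {j : ℤ | a n.succ ≤ ((j : ℝ) : EReal) ∧ j ≤ y}.Finite := by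
  have hlt : a n.castSucc < a n.succ := ha.strictMono n.castSucc_lt_succ
  rcases ha.mem n.succ with h | h | ⟨l, h⟩
  · rw [h] at hlt
    exact absurd hlt not_lt_bot
  · refine Set.Finite.subset finite_empty fun j hj => ?_
    rw [mem_ofPred_eq, h, top_le_iff] at hj
    exact EReal.coe_ne_top _ hj.1
  · refine (Set.finite_Icc l y).subset fun j hj => ⟨?_, hj.2⟩
    have := hj.1
    rw [h] at this
    exact_mod_cast this

theorem IsLevelSequence.finite_below (ha : M.IsLevelSequence a) (n : Fin N) (y : ℤ) :
    {j : ℤ | y ≤ j ∧ ((j : ℝ) : EReal) < a n.castSucc}.Finite := by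
  have hlt : a n.castSucc < a n.succ := ha.strictMono n.castSucc_lt_succ
  rcases ha.mem n.castSucc with h | h | ⟨l, h⟩
  · refine Set.Finite.subset finite_empty fun j hj => ?_
    rw [mem_ofPred_eq, h] at hj
    exact not_lt_bot hj.2
  · rw [h] at hlt
    exact absurd hlt not_top_lt
  · refine (Set.finite_Ico y l).subset fun j hj => ⟨hj.1, ?_⟩
    have := hj.2
    rw [h] at this
    exact_mod_cast this

theorem IsLevelSequence.finsum_above_succ (ha : M.IsLevelSequence a) (n : Fin N) (y : ℤ)
    (hy : ¬ a n.succ ≤ (((y + 1 : ℤ) : ℝ) : EReal) → M.terminalPrice a y = M.v n) :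
    ∑ᶠ (j : ℤ) (_ : a n.succ ≤ ((j : ℝ) : EReal) ∧ j ≤ y + 1), (M.terminalPrice a (j - 1) - M.v n)
      = M.terminalPrice a y - M.v n + ∑ᶠ (j : ℤ) (_ : a n.succ ≤ ((j : ℝ) : EReal) ∧ j ≤ y),
          (M.terminalPrice a (j - 1) - M.v n) := by
  by_cases h : a n.succ ≤ (((y + 1 : ℤ) : ℝ) : EReal)
  · have hset : {j : ℤ | a n.succ ≤ ((j : ℝ) : EReal) ∧ j ≤ y + 1}
        = insert (y + 1) {j : ℤ | a n.succ ≤ ((j : ℝ) : EReal) ∧ j ≤ y} := by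
      ext j
      simp only [mem_ofPred_eq, mem_insert_iff]
      constructor
      · rintro ⟨h1, h2⟩
        rcases eq_or_lt_of_le h2 with h3 | h3
        · exact Or.inl h3
        · exact Or.inr ⟨h1, by omega⟩
      · rintro (rfl | ⟨h1, h2⟩)
        · exact ⟨h, le_rfl⟩
        · exact ⟨h1, by omega⟩
    have key := finsum_mem_insert (fun j : ℤ => M.terminalPrice a (j - 1) - M.v n)
      (s := {j : ℤ | a n.succ ≤ ((j : ℝ) : EReal) ∧ j ≤ y}) (a := y + 1)
      (fun h => by have := h.2; omega) (ha.finite_above M n y)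
    rw [← hset, add_sub_cancel_right] at key
    exact key
  · rw [hy h, sub_self, zero_add]
    refine finsum_congr fun j => finsum_congr_Prop
      (propext ⟨fun h1 => ⟨h1.1, ?_⟩, fun h1 => ⟨h1.1, by omega⟩⟩)
      fun _ => rfl
    rcases eq_or_lt_of_le h1.2 with h3 | h3
    · exact absurd (h3 ▸ h1.1) h
    · omega

theorem IsLevelSequence.finsum_below_pred (ha : M.IsLevelSequence a) (n : Fin N) (y : ℤ)
    (hy : ¬ (((y - 1 : ℤ) : ℝ) : EReal) < a n.castSucc → M.terminalPrice a y = M.v n) :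
    ∑ᶠ (j : ℤ) (_ : y - 1 ≤ j ∧ ((j : ℝ) : EReal) < a n.castSucc),
        (M.v n - M.terminalPrice a (j + 1))
      = M.v n - M.terminalPrice a y + ∑ᶠ (j : ℤ) (_ : y ≤ j ∧ ((j : ℝ) : EReal) < a n.castSucc),
          (M.v n - M.terminalPrice a (j + 1)) := by
  by_cases h : (((y - 1 : ℤ) : ℝ) : EReal) < a n.castSucc
  · have hset : {j : ℤ | y - 1 ≤ j ∧ ((j : ℝ) : EReal) < a n.castSucc}
        = insert (y - 1) {j : ℤ | y ≤ j ∧ ((j : ℝ) : EReal) < a n.castSucc} := by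
      ext j
      simp only [mem_ofPred_eq, mem_insert_iff]
      constructor
      · rintro ⟨h1, h2⟩
        rcases eq_or_lt_of_le h1 with h3 | h3
        · exact Or.inl h3.symm
        · exact Or.inr ⟨by omega, h2⟩
      · rintro (rfl | ⟨h1, h2⟩)
        · exact ⟨le_rfl, h⟩
        · exact ⟨by omega, h2⟩
    have key := finsum_mem_insert (fun j : ℤ => M.v n - M.terminalPrice a (j + 1))
      (s := {j : ℤ | y ≤ j ∧ ((j : ℝ) : EReal) < a n.castSucc}) (a := y - 1)
      (fun h => by have := h.1; omega) (ha.finite_below M n y)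
    rw [← hset, sub_add_cancel] at key
    exact key
  · rw [hy h, sub_self, zero_add]
    refine finsum_congr fun j => finsum_congr_Prop
      (propext ⟨fun h1 => ⟨?_, h1.2⟩, fun h1 => ⟨by omega, h1.2⟩⟩)
      fun _ => rfl
    rcases eq_or_lt_of_le h1.1 with h3 | h3
    · exact absurd (h3 ▸ h1.2) h
    · omega

/-- The shift by one below the middle level makes the sums above and below it fit together: across
the middle level both are empty, and the demand is in the `n`-th interval. -/
theorem terminalUS_succ (ha : M.IsLevelSequence a) (n : Fin N) (y : ℤ) :
    M.terminalUS a n (y + 1) - M.terminalUS a n y = M.terminalPrice a y - M.v n := by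
  by_cases h : Above a n y
  · have h' : Above a n (y + 1) := h.mono (by omega)
    rw [terminalUS, terminalUS, if_pos h, if_pos h', terminalU, terminalU, if_pos h, if_pos h',
      ha.finsum_above_succ, add_sub_cancel_right]
    intro hy
    refine ha.terminalPrice_eq M ⟨?_, lt_of_lt_of_le ?_ (not_le.1 hy).le⟩
    · rcases ha.interval_cases M n with ⟨h1, -, -⟩ | ⟨k, -, -, h3⟩ | ⟨k, l, h1, h2, hkl, h3, -⟩
      · rw [h1]
        exact bot_le
      · exact absurd h (h3 y)
      · have := (h3 y).1 h
        rw [h1]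
        have : k ≤ y := by omega
        exact_mod_cast this
    · exact_mod_cast lt_add_one y
  by_cases h' : Above a n (y + 1)
  · -- the middle level is `y + 1 / 2`, so that `y` is in the interval
    obtain ⟨k, l, h1, h2, hkl, h3, h4⟩ : ∃ k l : ℤ, a n.castSucc = ((k : ℝ) : EReal) ∧
        a n.succ = ((l : ℝ) : EReal) ∧ k < l ∧ (∀ y, Above a n y ↔ k + l - 1 < 2 * y) ∧
          ∀ y, k + l - 1 ≠ 2 * y := by
      rcases ha.interval_cases M n with ⟨-, -, h3⟩ | ⟨k, -, -, h3⟩ | h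
      · exact absurd (h3 y) h
      · exact absurd h' (h3 _)
      · exact h
    have hy1 := (h3 _).1 h'
    have hy2 := mt (h3 _).2 h
    have hy3 := h4 y
    have hP : M.terminalPrice a y = M.v n := by
      refine ha.terminalPrice_eq M ⟨?_, ?_⟩
      · rw [h1]
        have : k ≤ y := by omega
        exact_mod_cast this
      · rw [h2]
        have : y < l := by omega
        exact_mod_cast this
    have hn : ¬ Above a n (y - 1) := fun h0 => h (h0.mono (by omega))
    rw [terminalUS, terminalUS, if_neg h, if_pos h', terminalU, terminalU, if_pos h', if_neg hn, hP,
      ha.finsum_below_pred M n y fun _ => hP, hP, h1, h2]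
    have e1 : ∀ j : ℤ, ¬ (((l : ℝ) : EReal) ≤ ((j : ℝ) : EReal) ∧ j ≤ y + 1) := by
      rintro j ⟨hj1, hj2⟩
      have : l ≤ j := by exact_mod_cast hj1
      omega
    have e2 : ∀ j : ℤ, ¬ (y ≤ j ∧ ((j : ℝ) : EReal) < ((k : ℝ) : EReal)) := by
      rintro j ⟨hj1, hj2⟩
      have : j < k := by exact_mod_cast hj2
      omega
    simp only [e1, e2, finsum_false, finsum_zero]
    ring
  · have hn : ¬ Above a n (y - 1) := fun h0 => h (h0.mono (by omega))
    rw [terminalUS, terminalUS, if_neg h, if_neg h', add_sub_cancel_right, terminalU, terminalU,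
      if_neg h, if_neg hn, ha.finsum_below_pred]
    · ring
    · intro hy
      refine ha.terminalPrice_eq M ⟨(not_lt.1 hy).trans ?_, ?_⟩
      · exact_mod_cast (sub_one_lt y).le
      · rcases ha.interval_cases M n with ⟨-, -, h3⟩ | ⟨k, -, h2, h3⟩ | ⟨k, l, h1, h2, hkl, h3, -⟩
        · exact absurd (h3 _) h'
        · rw [h2]
          exact EReal.coe_lt_top _
        · have := mt (h3 (y + 1)).2 h'
          rw [h2]
          have : y < l := by omega
          exact_mod_cast this

theorem terminalU_nonneg (ha : M.IsLevelSequence a) (n : Fin N) (y : ℤ) :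
    0 ≤ M.terminalU a n y := by
  have hv : ∀ m, ∀ j, InInterval a m j → M.terminalPrice a j = M.v m := fun m j hj =>
    ha.terminalPrice_eq M hj
  have hcmp : ∀ i j : Fin (N + 1), a i < a j → i < j := fun i j h => ha.strictMono.lt_iff_lt.1 h
  rw [terminalU]
  split_ifs with h
  · refine finsum_nonneg fun j => finsum_nonneg fun hj => ?_
    obtain ⟨m, hm⟩ := ha.cover (j - 1)
    rw [hv m _ hm, sub_nonneg]
    refine M.v_strictMono.monotone ?_
    -- If `m < n`, then `j - 1 < a_{m+1} ≤ a_n < a_{n+1} ≤ j`, where there is no integer for `a_n`.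
    by_contra hlt
    have h1 : m.succ ≤ n.castSucc := by
      rw [Fin.le_def, Fin.val_succ, Fin.val_castSucc]
      exact Fin.lt_def.1 (not_le.1 hlt)
    have h2 : (((j - 1 : ℤ) : ℝ) : EReal) < a n.castSucc :=
      hm.2.trans_le (ha.strictMono.monotone h1)
    rcases ha.interval_cases M n with ⟨h3, -, -⟩ | ⟨k, -, h3, -⟩ | ⟨k, l, h3, h4, hkl, -⟩
    · rw [h3] at h2
      exact not_lt_bot h2
    · rw [h3, top_le_iff] at hj
      exact EReal.coe_ne_top _ hj.1
    · rw [h3] at h2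
      rw [h4] at hj
      have h5 : j - 1 < k := by exact_mod_cast h2
      have h6 : l ≤ j := by exact_mod_cast hj.1
      omega
  · refine finsum_nonneg fun j => finsum_nonneg fun hj => ?_
    obtain ⟨m, hm⟩ := ha.cover (j + 1)
    rw [hv m _ hm, sub_nonneg]
    refine M.v_strictMono.monotone ?_
    -- If `n < m`, then `j < a_n < a_{n+1} ≤ a_m ≤ j + 1`, where there is no integer for `a_n`.
    by_contra hlt
    have h1 : n.succ ≤ m.castSucc := by
      rw [Fin.le_def, Fin.val_succ, Fin.val_castSucc]
      exact Fin.lt_def.1 (not_le.1 hlt)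
    have h2 : a n.succ ≤ (((j + 1 : ℤ) : ℝ) : EReal) :=
      (ha.strictMono.monotone h1).trans hm.1
    rcases ha.interval_cases M n with ⟨h3, -, -⟩ | ⟨k, -, h3, -⟩ | ⟨k, l, h3, h4, hkl, -⟩
    · rw [h3] at hj
      exact not_lt_bot hj.2
    · rw [h3, top_le_iff] at h2
      exact EReal.coe_ne_top _ h2
    · rw [h4] at h2
      rw [h3] at hj
      have h5 : j < k := by exact_mod_cast hj.2
      have h6 : l ≤ j + 1 := by exact_mod_cast h2
      omega

theorem terminalUS_nonneg (ha : M.IsLevelSequence a) (n : Fin N) (y : ℤ) :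
    0 ≤ M.terminalUS a n y := by
  rw [terminalUS]
  split_ifs
  · exact M.terminalU_nonneg ha n y
  · exact M.terminalU_nonneg ha n _

theorem integrable_p (a : Fin (N + 1) → EReal) (y : ℤ) : Integrable (M.p a y) :=
  (M.continuous_p a y).integrable_of_hasCompactSupport (HasCompactSupport.of_compactSpace _)

/-- The increments of `US` in the demand. -/
theorem US_succ (ha : M.IsLevelSequence a) (n : Fin N) (y : ℤ) (t : I) :
    M.US a n (y + 1) t - M.US a n y t = M.p a y t - M.v n := by
  have h1 := M.p_sub_terminalPrice a y t
  have h2 := M.terminalUS_succ ha n y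
  have i : ∀ z w, IntegrableOn (fun r => M.p a z r - M.p a w r) (Ioc t 1) := fun z w =>
    ((M.integrable_p a z).sub (M.integrable_p a w)).integrableOn
  have h3 : ∫ r in Ioc t 1, (M.p a (y + 1) r - 2 * M.p a y r + M.p a (y - 1) r)
      = (∫ r in Ioc t 1, (M.p a (y + 1) r - M.p a y r))
        - ∫ r in Ioc t 1, (M.p a y r - M.p a (y - 1) r) := by
    rw [← integral_sub (i _ _) (i _ _)]
    congr 1
    funext r
    ring
  rw [US_eq, US_eq, add_sub_cancel_right]
  rw [h3] at h1
  linarith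

theorem tendsto_US (a : Fin (N + 1) → EReal) (n : Fin N) (y : ℤ) :
    Tendsto (M.US a n y) (𝓝[<] 1) (𝓝 (M.US a n y 1)) := by
  have h : ∀ s, |M.US a n y s - M.US a n y 1| ≤ M.β * (2 * M.valueBound * (1 - s)) := by
    intro s
    rw [US_eq, US_eq, Ioc_self, setIntegral_empty, mul_zero, add_zero, add_sub_cancel_left, abs_mul,
      NNReal.abs_eq]
    refine mul_le_mul_of_nonneg_left ?_ (NNReal.coe_nonneg _)
    have h1 := norm_setIntegral_le_of_norm_le_const (μ := (volume : Measure I)) (s := Ioc s 1)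
      (f := fun r => M.p a y r - M.p a (y - 1) r) (C := 2 * M.valueBound) (measure_lt_top _ _)
      (fun r _ => by
        rw [two_mul]
        exact (abs_sub _ _).trans (add_le_add (M.abs_p_le a _ r) (M.abs_p_le a _ r)))
    rwa [Measure.real, unitInterval.volume_Ioc, Icc.coe_one,
      ENNReal.toReal_ofReal (sub_nonneg.2 s.2.2)] at h1
  rw [tendsto_iff_dist_tendsto_zero]
  refine squeeze_zero (fun _ => dist_nonneg) (fun s => h s) ?_
  have hc : Continuous fun s : I => (M.β : ℝ) * (2 * M.valueBound * (1 - (s : ℝ))) := by fun_prop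
  have := (hc.tendsto 1).mono_left (nhdsWithin_le_nhds (s := Iio 1))
  simpa using this

end Market

/-! ### Verification for a strategy -/

theorem IsStepPath.leftLim_eq {w w' : I → ℤ} (h : IsStepPath w w') (t : I) :
    Function.leftLim w t = w' t := by
  rcases eq_or_lt_of_le (show (0 : I) ≤ t from bot_le) with h0 | h0
  · rw [← h0]
    exact (leftLim_eq_of_isBot isBot_bot).trans h.zero.symm
  · have := IsStepPath.nhdsLT_neBot h0
    exact leftLim_eq_of_tendsto (tendsto_const_nhds.congr' ((h.left t).mono fun _ hs => hs.symm))

namespace Market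

variable {N : ℕ} {M : Market Ω N}

theorem isJumpPart_jumpWith (X : I → Ω → ℕ) {W : I → Ω → ℕ}
    (hW : ∀ ω, IsCountingPath fun t => W t ω) (hWm : ∀ t, Measurable (W t)) :
    IsJumpPart X (jumpWith X W) where
  le s ω := (Nat.mul_le_mul_left _ ((hW ω).jump_le_one s)).trans (by simp)
  factor := ⟨_, IsGridLimit.jump hW hWm hW hWm fun b _ => (b : ℝ), fun s ω => by
    rw [jumpWith, Nat.cast_mul, mul_comm]⟩

theorem isJumpPart_jumpAlone (X : I → Ω → ℕ) :
    IsJumpPart X (M.jumpAlone X) where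
  le s ω := by
    have : (1 - jump (fun t => M.ZB t ω) s) * (1 - jump (fun t => M.ZS t ω) s) ≤ 1 * 1 :=
      Nat.mul_le_mul (Nat.sub_le _ _) (Nat.sub_le _ _)
    exact (Nat.mul_le_mul_left _ this).trans (by simp)
  factor := ⟨_, IsGridLimit.jump M.poisson_ZB.path M.poisson_ZB.measurable M.poisson_ZS.path
    M.poisson_ZS.measurable fun b c => (((1 - b) * (1 - c) : ℕ) : ℝ), fun s ω => by
      rw [jumpAlone, Nat.cast_mul, mul_comm]⟩

namespace Strategy

variable {q : ℤ → I → ℝ} {y₀ : ℤ} (S : M.Strategy q y₀)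

theorem isCountingProcess_XB : IsCountingProcess M.P S.XB where
  path := S.path_XB
  measurable t := (S.adapted_XB t).mono (Filtration.le _ t) le_rfl
  integrable := by
    refine ⟨(measurable_from_top.comp ((S.adapted_XB 1).mono
      (Filtration.le _ 1) le_rfl)).aestronglyMeasurable, ?_⟩
    rw [hasFiniteIntegral_iff_ofReal (.of_forall fun ω => Nat.cast_nonneg _)]
    simpa using S.integrable_XB

theorem isCountingProcess_XS : IsCountingProcess M.P S.XS where
  path := S.path_XS
  measurable t := (S.adapted_XS t).mono (Filtration.le _ t) le_rfl
  integrable := by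
    refine ⟨(measurable_from_top.comp ((S.adapted_XS 1).mono
      (Filtration.le _ 1) le_rfl)).aestronglyMeasurable, ?_⟩
    rw [hasFiniteIntegral_iff_ofReal (.of_forall fun ω => Nat.cast_nonneg _)]
    simpa using S.integrable_XS

/-- The left limit of the total demand, in terms of those of the orders. -/
noncomputable def Yleft (t : I) (ω : Ω) : ℤ :=
  y₀ + M.Zleft t ω + (Function.leftLim (fun s => S.XB s ω) t : ℕ)
    - (Function.leftLim (fun s => S.XS s ω) t : ℕ)

theorem isStepPath_Y (ω : Ω) : IsStepPath (fun s => S.Y s ω) fun s => S.Yleft s ω :=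
  ((M.isStepPath_Z ω).prodMk ((S.path_XB ω).isStepPath.prodMk (S.path_XS ω).isStepPath)).map
    fun x : ℤ × ℕ × ℕ => y₀ + x.1 + (x.2.1 : ℤ) - x.2.2

theorem Yminus_eq (t : I) (ω : Ω) : S.Yminus t ω = S.Yleft t ω :=
  (S.isStepPath_Y ω).leftLim_eq t

theorem Y_eq_Yleft_add (t : I) (ω : Ω) :
    S.Y t ω = S.Yleft t ω + jump (fun s => M.ZB s ω) t - jump (fun s => M.ZS s ω) t
      + jump (fun s => S.XB s ω) t - jump (fun s => S.XS s ω) t := by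
  have h1 := (M.poisson_ZB.path ω).leftLim_add_jump t
  have h2 := (M.poisson_ZS.path ω).leftLim_add_jump t
  have h3 := (S.path_XB ω).leftLim_add_jump t
  have h4 := (S.path_XS ω).leftLim_add_jump t
  rw [Y, demand, Z, Yleft, Zleft]
  omega

theorem measurable_Y (t : I) : Measurable[M.insiderFiltration S.𝓗 t] (S.Y t) :=
  (Measurable.of_discrete (f := fun x : ℤ × ℕ × ℕ => y₀ + x.1 + (x.2.1 : ℤ) - x.2.2)).comp
    ((M.measurable_insider_Z S.𝓗 t).prodMk ((S.adapted_XB t).prodMk (S.adapted_XS t)))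

theorem measurableSet_event (n : Fin N) (y : ℤ) (t : I) :
    MeasurableSet[M.insiderFiltration S.𝓗 t] (S.event n y t) := by
  have h1 : M.valueSigma ≤ M.insiderFiltration S.𝓗 t := by
    refine le_trans ?_ (Filtration.le_rightCont _ t)
    exact (le_sup_left.trans le_sup_left : M.valueSigma ≤ M.valueSigma ⊔
      M.noiseFiltration t ⊔ S.𝓗 t).trans le_sup_left
  have h2 : MeasurableSet[M.insiderFiltration S.𝓗 t] {ω | S.Y t ω = y} :=
    S.measurable_Y t (measurableSet_singleton y)
  have h3 : MeasurableSet[M.insiderFiltration S.𝓗 t] {ω | M.value ω = M.v n} :=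
    h1 _ (comap_measurable M.value (measurableSet_singleton (M.v n)))
  exact h2.inter h3

end Strategy

variable {a : Fin (N + 1) → EReal}

/-- The upper bound for one strategy: its profit on an event `A` that is known at time `t`, on
which `Y_t = y`, is at most the value of the bounding function on this event. -/
theorem Strategy.setIntegral_profitRate_le (ha : M.IsLevelSequence a) {y₀ : ℤ}
    (S : M.Strategy (M.p a) y₀) (n : Fin N) (y : ℤ) (t : I) :
    ∫ ω in S.event n y t, (∫ r in Ioc t 1, S.profitRate (M.v n) r ω) ∂M.P
      ≤ M.P.real (S.event n y t) * M.US a n y t := by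
  have := M.isProbabilityMeasure
  set A := S.event n y t with hA
  have hAF : MeasurableSet[M.insiderFiltration S.𝓗 t] A := S.measurableSet_event n y t
  have hAm : MeasurableSet A := Filtration.le _ t _ hAF
  have cXB := S.isCountingProcess_XB
  have cXS := S.isCountingProcess_XS
  have cZB := M.isCompensated_ZB S.indep_𝓗
  have cZS := M.isCompensated_ZS S.indep_𝓗
  -- the integrands, restricted to the event and to the time after `t`
  set w : ℤ → I → Ω → ℝ := fun k => window t 1 A fun s ω => M.v n - M.p a (S.Yleft s ω + k) s
    with hw
  have hwin : ∀ k : ℤ, ∃ ξ, IsLeftLimit (M.insiderFiltration S.𝓗)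
      (M.valueBound + M.valueBound) ξ (w k) := fun k =>
    ⟨_, IsLeftLimit.of_stepPath S.isStepPath_Y S.measurable_Y
      (φ := fun y s => M.v n - M.p a (y + k) s)
      (fun y => continuous_const.sub (M.continuous_p a _))
      (fun y s => (abs_sub _ _).trans (add_le_add (M.abs_v_le n) (M.abs_p_le a _ s))) t 1 hAF⟩
  choose ξ hξ using hwin
  have pBB := isJumpPart_jumpAlone (M := M) S.XB
  have pBT := isJumpPart_jumpWith S.XB M.poisson_ZB.path M.poisson_ZB.measurable
  have pBS := isJumpPart_jumpWith S.XB M.poisson_ZS.path M.poisson_ZS.measurable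
  have pSS := isJumpPart_jumpAlone (M := M) S.XS
  have pST := isJumpPart_jumpWith S.XS M.poisson_ZS.path M.poisson_ZS.measurable
  have pSB := isJumpPart_jumpWith S.XS M.poisson_ZB.path M.poisson_ZB.measurable
  have partB := IsJumpPart.refl M.ZB
  have partS := IsJumpPart.refl M.ZS
  have eBB := S.intensity_BB.integral_prod_eq cXB pBB (hξ 1)
  have eBT := S.intensity_BT.integral_prod_eq cXB pBT (hξ 2)
  have eBS := S.intensity_BS.integral_prod_eq cXB pBS (hξ 0)
  have eSS := S.intensity_SS.integral_prod_eq cXS pSS (hξ (-1))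
  have eST := S.intensity_ST.integral_prod_eq cXS pST (hξ (-2))
  have eSB := S.intensity_SB.integral_prod_eq cXS pSB (hξ 0)
  have iBB := cXB.integrable_tsum pBB (hξ 1)
  have iBT := cXB.integrable_tsum pBT (hξ 2)
  have iBS := cXB.integrable_tsum pBS (hξ 0)
  have iSS := cXS.integrable_tsum pSS (hξ (-1))
  have iST := cXS.integrable_tsum pST (hξ (-2))
  have iSB := cXS.integrable_tsum pSB (hξ 0)
  have eZB := cZB.integral_tsum_eq (hξ 0).neg
  have eZS := cZS.integral_tsum_eq (hξ (-1))
  have iZB := cZB.integrable_tsum partB (hξ 0).neg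
  have iZS := cZS.integrable_tsum partS (hξ (-1))
  have wint : ∀ k, Integrable (fun z : Ω × I => w k z.2 z.1) (M.P.prod volume) := fun k =>
    (integrable_const (M.valueBound + M.valueBound)).mono'
      (hξ k).measurable_uncurry.aestronglyMeasurable (.of_forall fun z => (hξ k).bound' _ _)
  -- the profit as an integral over the product space
  set R : Ω × I → ℝ := fun z => w 1 z.2 z.1 * S.θBB z.2 z.1 + w 2 z.2 z.1 * S.θBT z.2 z.1
    + w 0 z.2 z.1 * S.θBS z.2 z.1 - w (-1) z.2 z.1 * S.θSS z.2 z.1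
    - w (-2) z.2 z.1 * S.θST z.2 z.1 - w 0 z.2 z.1 * S.θSB z.2 z.1 with hR
  have iR : Integrable R (M.P.prod volume) :=
    ((((eBB.1.add eBT.1).add eBS.1).sub eSS.1).sub eST.1).sub eSB.1
  set L : Ω → ℝ := fun ω => ∑' s : I, w 1 s ω * (M.jumpAlone S.XB s ω : ℝ)
    + ∑' s : I, w 2 s ω * (jumpWith S.XB M.ZB s ω : ℝ)
    + ∑' s : I, w 0 s ω * (jumpWith S.XB M.ZS s ω : ℝ)
    - ∑' s : I, w (-1) s ω * (M.jumpAlone S.XS s ω : ℝ)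
    - ∑' s : I, w (-2) s ω * (jumpWith S.XS M.ZS s ω : ℝ)
    - ∑' s : I, w 0 s ω * (jumpWith S.XS M.ZB s ω : ℝ) with hL
  have iL : Integrable L M.P := ((((iBB.add iBT).add iBS).sub iSS).sub iST).sub iSB
  have hRL : ∫ z, R z ∂(M.P.prod volume) = ∫ ω, L ω ∂M.P := by
    have r1 := integral_sub ((((eBB.1.add eBT.1).add eBS.1).sub eSS.1).sub eST.1) eSB.1
    have r2 := integral_sub (((eBB.1.add eBT.1).add eBS.1).sub eSS.1) eST.1
    have r3 := integral_sub ((eBB.1.add eBT.1).add eBS.1) eSS.1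
    have r4 := integral_add (eBB.1.add eBT.1) eBS.1
    have r5 := integral_add eBB.1 eBT.1
    have l1 := integral_sub ((((iBB.add iBT).add iBS).sub iSS).sub iST) iSB
    have l2 := integral_sub (((iBB.add iBT).add iBS).sub iSS) iST
    have l3 := integral_sub ((iBB.add iBT).add iBS) iSS
    have l4 := integral_add (iBB.add iBT) iBS
    have l5 := integral_add iBB iBT
    simp only [Pi.add_apply, Pi.sub_apply] at r1 r2 r3 r4 r5 l1 l2 l3 l4 l5
    rw [hR, hL]
    rw [r1, r2, r3, r4, r5, l1, l2, l3, l4, l5, eBB.2, eBT.2, eBS.2, eSS.2, eST.2, eSB.2]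
  have hprofit : ∫ ω in A, (∫ r in Ioc t 1, S.profitRate (M.v n) r ω) ∂M.P
      = ∫ z, R z ∂(M.P.prod volume) := by
    rw [integral_prod _ iR, ← integral_indicator hAm]
    congr 1
    funext ω
    by_cases hω : ω ∈ A
    · rw [indicator_of_mem hω, ← integral_indicator measurableSet_Ioc]
      congr 1
      funext r
      by_cases hr : r ∈ Ioc t 1
      · have hm : t < r ∧ r ≤ 1 ∧ ω ∈ A := ⟨hr.1, hr.2, hω⟩
        rw [indicator_of_mem hr]
        simp only [hR, hw, window_of_mem _ hm, profitRate, Yminus_eq, add_zero, ← sub_eq_add_neg]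
      · have hm : ¬ (t < r ∧ r ≤ 1 ∧ ω ∈ A) := fun h => hr ⟨h.1, h.2.1⟩
        rw [indicator_of_notMem hr]
        simp only [hR, hw, window_of_notMem _ hm]
        ring
    · rw [indicator_of_notMem hω]
      have hm : ∀ r, ¬ (t < r ∧ r ≤ 1 ∧ ω ∈ A) := fun r h => hω h.2.2
      simp only [hR, hw, window_of_notMem _ (hm _), zero_mul, add_zero, sub_zero, integral_zero]
  -- the pathwise bound
  have hpath : ∀ᵐ ω ∂M.P, L ω ≤ A.indicator (fun _ => M.US a n y t) ω
      - M.β * (∫ r, (w (-1) r ω - w 0 r ω))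
      + ((∑' s : I, -w 0 s ω * (jump (fun t => M.ZB t ω) s : ℝ))
        + ∑' s : I, w (-1) s ω * (jump (fun t => M.ZS t ω) s : ℝ)) := by
    filter_upwards [ae_no_common_jump M.poisson_ZB M.poisson_ZS M.indep_ZB_ZS] with ω hω
    by_cases hωA : ω ∈ A
    swap
    · have hm : ∀ r, ¬ (t < r ∧ r ≤ 1 ∧ ω ∈ A) := fun r h => hωA h.2.2
      rw [indicator_of_notMem hωA]
      simp only [hL, hw, window_of_notMem _ (hm _), zero_mul, neg_zero, sub_zero, add_zero,
        tsum_zero, integral_zero, mul_zero, le_refl]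
    have fB := (M.poisson_ZB.path ω).finite_support_jump
    have fS := (M.poisson_ZS.path ω).finite_support_jump
    have gB := (S.path_XB ω).finite_support_jump
    have gS := (S.path_XS ω).finite_support_jump
    set J := (fB.toFinset ∪ fS.toFinset) ∪ (gB.toFinset ∪ gS.toFinset) with hJ
    have jZB : ∀ s, jump (fun t => M.ZB t ω) s ≠ 0 → s ∈ J := fun s hs => by simp [hJ, hs]
    have jZS : ∀ s, jump (fun t => M.ZS t ω) s ≠ 0 → s ∈ J := fun s hs => by simp [hJ, hs]
    have jXB : ∀ s, jump (fun t => S.XB t ω) s ≠ 0 → s ∈ J := fun s hs => by simp [hJ, hs]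
    have jXS : ∀ s, jump (fun t => S.XS t ω) s ≠ 0 → s ∈ J := fun s hs => by simp [hJ, hs]
    have jY : ∀ s, S.Yleft s ω ≠ S.Y s ω → s ∈ J := by
      intro s hs
      by_contra hn
      refine hs ?_
      rw [S.Y_eq_Yleft_add, not_imp_comm.1 (jZB s) hn, not_imp_comm.1 (jZS s) hn,
        not_imp_comm.1 (jXB s) hn, not_imp_comm.1 (jXS s) hn]
      simp
    have main := sum_jumpProfit_le (p := M.p a) (T := M.terminalUS a n) (v := M.v n) (β := M.β)
      (M.continuous_p a) (ha.monotone_p M) (M.terminalUS_nonneg ha n) (g := M.US a n)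
      (M.US_eq a n) (M.US_succ ha n) (M.poisson_ZB.path ω) (M.poisson_ZS.path ω)
      (S.path_XB ω) (S.path_XS ω) hω (S.isStepPath_Y ω) (fun s => S.Y_eq_Yleft_add s ω) J jY t
    have hYt : S.Y t ω = y := hωA.1
    rw [hYt] at main
    have hws : ∀ k s, w k s ω = if t < s then M.v n - M.p a (S.Yleft s ω + k) s else 0 := by
      intro k s
      by_cases hs : t < s
      · rw [if_pos hs]
        exact window_of_mem _ ⟨hs, le_top, hωA⟩
      · rw [if_neg hs]
        exact window_of_notMem _ fun h => hs h.1
    have hint : ∫ r, (w (-1) r ω - w 0 r ω)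
        = ∫ r in Ioc t 1, (M.p a (S.Yleft r ω) r - M.p a (S.Yleft r ω - 1) r) := by
      rw [← integral_indicator measurableSet_Ioc]
      congr 1
      funext r
      by_cases hr : t < r
      · rw [indicator_of_mem (show r ∈ Ioc t 1 from ⟨hr, le_top⟩), hws, hws, if_pos hr, if_pos hr,
          add_zero, ← sub_eq_add_neg]
        ring
      · rw [indicator_of_notMem (fun h => hr h.1), hws, hws, if_neg hr, if_neg hr, sub_zero]
    have hLJ : L ω = ∑ s ∈ J with t < s, jumpProfit (fun y => M.p a y s) (M.v n) (S.Yleft s ω)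
        (jump (fun t => M.ZB t ω) s) (jump (fun t => M.ZS t ω) s) (jump (fun t => S.XB t ω) s)
        (jump (fun t => S.XS t ω) s) := by
      rw [hL]
      dsimp only
      rw [pBB.tsum_mul_eq _ jXB, pBT.tsum_mul_eq _ jXB, pBS.tsum_mul_eq _ jXB,
        pSS.tsum_mul_eq _ jXS, pST.tsum_mul_eq _ jXS, pSB.tsum_mul_eq _ jXS,
        ← Finset.sum_add_distrib, ← Finset.sum_add_distrib, ← Finset.sum_sub_distrib,
        ← Finset.sum_sub_distrib, ← Finset.sum_sub_distrib, Finset.sum_filter]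
      refine Finset.sum_congr rfl fun s _ => ?_
      simp only [hws]
      by_cases hs : t < s
      · simp only [if_pos hs, jumpProfit, jumpAlone, jumpWith, add_zero, ← sub_eq_add_neg]
      · simp only [if_neg hs, zero_mul, add_zero, sub_zero]
    have hNJ : (∑' s : I, -w 0 s ω * (jump (fun t => M.ZB t ω) s : ℝ))
        + ∑' s : I, w (-1) s ω * (jump (fun t => M.ZS t ω) s : ℝ)
        = ∑ s ∈ J with t < s, ((M.p a (S.Yleft s ω) s - M.v n) * jump (fun t => M.ZB t ω) s
          + (M.v n - M.p a (S.Yleft s ω - 1) s) * jump (fun t => M.ZS t ω) s) := by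
      rw [partB.tsum_mul_eq (fun s => -w 0 s ω) jZB, partS.tsum_mul_eq (fun s => w (-1) s ω) jZS,
        ← Finset.sum_add_distrib, Finset.sum_filter]
      refine Finset.sum_congr rfl fun s _ => ?_
      simp only [hws]
      by_cases hs : t < s
      · simp only [if_pos hs, add_zero, ← sub_eq_add_neg, neg_sub]
      · simp only [if_neg hs, neg_zero, zero_mul, add_zero]
    rw [indicator_of_mem hωA, hint, hLJ, hNJ]
    exact main
  -- in expectation the noise orders are compensated
  have iκ : Integrable (fun z : Ω × I => w (-1) z.2 z.1 - w 0 z.2 z.1) (M.P.prod volume) :=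
    (wint (-1)).sub (wint 0)
  have iA : Integrable (A.indicator fun _ : Ω => M.US a n y t) M.P :=
    (integrable_const _).indicator hAm
  have iI : Integrable (fun ω => M.β * ∫ r, (w (-1) r ω - w 0 r ω)) M.P :=
    iκ.integral_prod_left.const_mul _
  rw [hprofit, hRL]
  refine (integral_mono_ae iL ((iA.sub iI).add (iZB.add iZS)) hpath).trans (le_of_eq ?_)
  have l1 := integral_add (iA.sub iI) (iZB.add iZS)
  have l2 := integral_sub iA iI
  have l3 := integral_add iZB iZS
  simp only [Pi.add_apply, Pi.sub_apply] at l1 l2 l3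
  have l4 : ∫ ω, (∫ r, (w (-1) r ω - w 0 r ω)) ∂M.P
      = ∫ z : Ω × I, w (-1) z.2 z.1 ∂(M.P.prod volume)
        - ∫ z : Ω × I, w 0 z.2 z.1 ∂(M.P.prod volume) := by
    rw [← integral_sub (wint (-1)) (wint 0), integral_prod _ iκ]
  have l5 : ∫ z : Ω × I, -w 0 z.2 z.1 ∂(M.P.prod volume)
      = -∫ z : Ω × I, w 0 z.2 z.1 ∂(M.P.prod volume) := integral_neg _
  simp only [Pi.add_apply, Pi.sub_apply]
  rw [l1, l2, l3, eZB, eZS, integral_indicator_const _ hAm, integral_const_mul, l4, l5,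
    smul_eq_mul]
  ring

theorem Strategy.expectedProfit_le (ha : M.IsLevelSequence a) {y₀ : ℤ}
    (S : M.Strategy (M.p a) y₀) (n : Fin N) (y : ℤ) (t : I) (h0 : M.P (S.event n y t) ≠ 0) :
    S.expectedProfit n y t ≤ M.US a n y t := by
  have := M.isProbabilityMeasure
  have h := S.setIntegral_profitRate_le ha n y t
  have hpos : 0 < (M.P (S.event n y t)).toReal := ENNReal.toReal_pos h0 (measure_ne_top _ _)
  rw [expectedProfit, ProbabilityTheory.cond, integral_smul_measure, ENNReal.toReal_inv,
    smul_eq_mul, inv_mul_le_iff₀ hpos]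
  exact h

/-! ### The strategy without orders -/

theorem isIntensity_zero (P : Measure Ω) (𝓕 : Filtration I mΩ) {J : I → Ω → ℕ}
    (hJ : ∀ s ω, J s ω = 0) : IsIntensity P 𝓕 J fun _ _ => 0 where
  predictable := @stronglyMeasurable_const _ _ 𝓕.predictable _ _
  projection C _ := by simp [hJ]

theorem jump_zero_path (t : I) : jump (fun _ => 0) t = 0 := Nat.zero_sub _

/-- The insider who never trades. -/
noncomputable def nullStrategy (M : Market Ω N) (q : ℤ → I → ℝ) (y₀ : ℤ) : M.Strategy q y₀ where
  𝓗 := ⊥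
  indep_𝓗 := M.indep_bot_filtration
  XB _ _ := 0
  XS _ _ := 0
  path_XB _ := ⟨rfl, monotone_const, fun _ => continuousWithinAt_const, fun _ => Nat.zero_le _⟩
  path_XS _ := ⟨rfl, monotone_const, fun _ => continuousWithinAt_const, fun _ => Nat.zero_le _⟩
  adapted_XB _ := measurable_const
  adapted_XS _ := measurable_const
  integrable_XB := by simp
  integrable_XS := by simp
  θBB _ _ := 0
  θBT _ _ := 0
  θBS _ _ := 0
  θSS _ _ := 0
  θST _ _ := 0
  θSB _ _ := 0
  intensity_BB := isIntensity_zero _ _ fun s ω => by simp [jumpAlone, jump_zero_path]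
  intensity_BT := isIntensity_zero _ _ fun s ω => by simp [jumpWith, jump_zero_path]
  intensity_BS := isIntensity_zero _ _ fun s ω => by simp [jumpWith, jump_zero_path]
  intensity_SS := isIntensity_zero _ _ fun s ω => by simp [jumpAlone, jump_zero_path]
  intensity_ST := isIntensity_zero _ _ fun s ω => by simp [jumpWith, jump_zero_path]
  intensity_SB := isIntensity_zero _ _ fun s ω => by simp [jumpWith, jump_zero_path]
  price_integrable_B := by simp [jump_zero_path]
  price_integrable_S := by simp [jump_zero_path]

theorem _root_.GlostenMilgrom.IsPoissonProcess.prob_eq_zero_ne {P : Measure Ω} {X : I → Ω → ℕ}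
    {β : ℝ≥0} (h : IsPoissonProcess X β P) (t : I) : P (X t ⁻¹' {0}) ≠ 0 := by
  have h1 : X t - X 0 = X t := by
    funext ω
    show X t ω - X 0 ω = X t ω
    rw [(h.path ω).zero, Nat.sub_zero]
  have h2 := h.law 0 t bot_le
  rw [h1] at h2
  rw [← Measure.map_apply (h.measurable t) (measurableSet_singleton 0), h2,
    poissonMeasure_singleton]
  simp only [pow_zero, mul_one, Nat.factorial_zero, Nat.cast_one, div_one, ne_eq,
    ENNReal.ofReal_eq_zero, not_le]
  exact Real.exp_pos _

/-- Without insider orders the demand stays at its initial value with positive probability. -/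
theorem prob_event_nullStrategy_ne (M : Market Ω N) (q : ℤ → I → ℝ) (n : Fin N) (y : ℤ) (t : I) :
    M.P ((nullStrategy M q y).event n y t) ≠ 0 := by
  have := M.isProbabilityMeasure
  have h1 : IndepFun (M.ZB t) (M.ZS t) M.P :=
    M.indep_ZB_ZS.comp (measurable_pi_apply t) (measurable_pi_apply t)
  have h2 : IndepFun M.value (fun ω => (M.ZB t ω, M.ZS t ω)) M.P :=
    M.indep_value.comp measurable_id (measurable_pi_apply t)
  have h3 : M.P (M.value ⁻¹' {M.v n} ∩ (fun ω => (M.ZB t ω, M.ZS t ω)) ⁻¹' {(0, 0)})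
      = M.P (M.value ⁻¹' {M.v n}) * (M.P (M.ZB t ⁻¹' {0}) * M.P (M.ZS t ⁻¹' {0})) := by
    rw [h2.measure_inter_preimage_eq_mul _ _ (measurableSet_singleton _)
      (measurableSet_singleton _), ← h1.measure_inter_preimage_eq_mul _ _
      (measurableSet_singleton _) (measurableSet_singleton _)]
    congr 2
    ext ω
    simp [Prod.ext_iff]
  have h4 : M.P (M.value ⁻¹' {M.v n} ∩ (fun ω => (M.ZB t ω, M.ZS t ω)) ⁻¹' {(0, 0)}) ≠ 0 := by
    rw [h3]
    exact mul_ne_zero (M.prob_pos n).ne'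
      (mul_ne_zero (M.poisson_ZB.prob_eq_zero_ne t) (M.poisson_ZS.prob_eq_zero_ne t))
  refine fun h0 => h4 (measure_mono_null ?_ h0)
  rintro ω ⟨hv, hz⟩
  have hz1 : M.ZB t ω = 0 := congrArg Prod.fst hz
  have hz2 : M.ZS t ω = 0 := congrArg Prod.snd hz
  refine ⟨?_, hv⟩
  simp [Strategy.Y, demand, nullStrategy, Z, hz1, hz2]

theorem zero_le_valueBefore (M : Market Ω N) (a : Fin (N + 1) → EReal) (n : Fin N) (y : ℤ)
    (t : I) : 0 ≤ M.valueBefore a n y t := by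
  have h : ((nullStrategy M (M.p a) y).expectedProfit n y t : EReal) = 0 := by
    rw [EReal.coe_eq_zero]
    simp [Strategy.expectedProfit, Strategy.profitRate, nullStrategy]
  rw [← h]
  exact le_iSup_of_le y (le_iSup_of_le (nullStrategy M (M.p a) y)
    (le_iSup_of_le (prob_event_nullStrategy_ne M (M.p a) n y t) le_rfl))

theorem valueBefore_le (ha : M.IsLevelSequence a) (n : Fin N) (y : ℤ) (t : I) :
    M.valueBefore a n y t ≤ ((M.US a n y t : ℝ) : EReal) :=
  iSup_le fun _ => iSup_le fun S => iSup_le fun h0 =>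
    EReal.coe_le_coe_iff.2 (S.expectedProfit_le ha n y t h0)

end Market

end GlostenMilgrom

theorem mainTheorem6 {Ω : Type*} [MeasurableSpace Ω] {N : ℕ}
    (M : GlostenMilgrom.Market Ω N) (a : Fin (N + 1) → EReal) (ha : M.IsLevelSequence a) :
    ∀ (n : Fin N) (y : ℤ) (t : unitInterval),
      M.valueFunction a n y t ≤ ((M.US a n y t : ℝ) : EReal) ∧
        ⊥ < M.valueFunction a n y t ∧ M.valueFunction a n y t < ⊤ := by
  intro n y t
  have key : 0 ≤ M.valueFunction a n y t ∧
      M.valueFunction a n y t ≤ ((M.US a n y t : ℝ) : EReal) := by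
    rw [GlostenMilgrom.Market.valueFunction]
    split_ifs with ht
    · subst ht
      have : (𝓝[<] (1 : unitInterval)).NeBot := GlostenMilgrom.IsStepPath.nhdsLT_neBot zero_lt_one
      constructor
      · exact le_limsup_of_frequently_le
          (.of_forall fun s => GlostenMilgrom.Market.zero_le_valueBefore M a n y s)
      · have hlim : Tendsto (fun s => ((M.US a n y s : ℝ) : EReal)) (𝓝[<] 1)
            (𝓝 ((M.US a n y 1 : ℝ) : EReal)) :=
          (continuous_coe_real_ereal.tendsto _).comp (M.tendsto_US a n y)
        rw [← hlim.limsup_eq]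
        exact limsup_le_limsup
          (.of_forall fun s => GlostenMilgrom.Market.valueBefore_le ha n y s)
    · exact ⟨GlostenMilgrom.Market.zero_le_valueBefore M a n y t,
        GlostenMilgrom.Market.valueBefore_le ha n y t⟩
  exact ⟨key.2, lt_of_lt_of_le EReal.bot_lt_zero key.1, lt_of_le_of_lt key.2 (EReal.coe_lt_top _)⟩
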